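/- Let $\Gamma$ be a group with a finite generating set $S$. A graph sequence $\mathcal G=\{G_n\}_{n\in\mathbb N}$ is a sequence of finite connected graphs of uniformly bounded degree with $|V(G_n)|\to\infty$. A sofic approximation of $\Gamma$ is a graph sequence $\mathcal G$ whose edges are directed and labelled by elements of $S$, and which converges in the Benjamini–Schramm sense to the Cayley graph $\mathrm{Cay}(\Gamma,S)$ (with an edge labelled $s$ from $g$ to $gs$ for all $g\in\Gamma$, $s\in S$): for every $r\in\mathbb N$, $$\lim_{n\to\infty}\frac{|\{x\in V(G_n) : B_r(G_n,x)\simeq B_r(\mathrm{Cay}(\Gamma,S),e)\}|}{|V(G_n)|}=1,$$ where $\simeq$ is isomorphism of rooted directed labelled graphs. Distances, degrees, edges and components below are those of the underlying undirected simple graphs. A sequence $\mathcal H=\{H_n\}$ of finite, not necessarily connected, graphs has property A if for all $\epsilon>0$ there are $R>0$ and maps $V(H_n)\to\ell^1(V(H_n))$, $x\mapsto\xi_x$, such that for all $n$: $\|\xi_x\|_1=1$ and $\xi_x$ is supported in the ball of radius $R$ about $x$ in $H_n$ for all $x\in V(H_n)$, and $\|\xi_x-\xi_y\|_1<\epsilon$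 for every edge $(x,y)$ of $H_n$ (vertices in different components are at infinite distance). A graph sequence $\mathcal G$ has property almost-A if there are sets $V_n'\subset V(G_n)$ with $\lim_{n\to\infty}|V_n'|/|V(G_n)|=0$ such that the sequence of induced subgraphs $\{G_n\setminus V_n'\}_{n\in\mathbb N}$, with their own path metrics, has property A. It is hyperfinite if for every $\epsilon>0$ there are a constant $K>0$ and sets $E_n\subset E(G_n)$ such that $\lim_{n\to\infty}|E_n|/|V(G_n)|$ exists and is less than $\epsilon$, and for all $n$ the connected components of $G_n\setminus E_n$ have at most $K$ vertices. Theorem. Let $\mathcal G$ be a sofic approximation of $\Gamma$. Then the following are equivalent: 1. $\Gamma$ is amenable; 2. $\mathcal G$ has property almost-A; 3. $\mathcal G$ is hyperfinite. Here $\Gamma$ is amenable if for every finite $T\subset\Gamma$ and every $\epsilon>0$ there is a finite nonempty $F\subset\Gamma$ with $|gF\,\triangle\,F|\le\epsilon|F|$ for all $g\in T$. -/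

import Mathlib

open Filter Topology

/-- A directed graph on the vertex set `V` whose edges carry labels in `L`: `G.edge s x y` says
that there is a directed edge labelled `s` from `x` to `y`.  Loops, and parallel edges with
different labels, are allowed, and the labelling need not be proper. -/
structure LabelledGraph (L V : Type*) where
  edge : L → V → V → Prop

namespace LabelledGraph

/-- The underlying graph: labels, directions and loops are forgotten. -/
def toSimpleGraph {L V : Type*} (G : LabelledGraph L V) : SimpleGraph V :=
  SimpleGraph.fromRel (fun x y => ∃ s, G.edge s x y)

/-- The vertices at (path) distance at most `r` from `x`. -/
def ball {L V : Type*} (G : LabelledGraph L V) (x : V) (r : ℕ) : Set V :=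
  {y | G.toSimpleGraph.edist x y ≤ r}

/-- `B_r(G, x) ≃ B_r(H, y)` as rooted, directed, labelled graphs: there is a bijection of the
(vertices of the) two balls that maps root to root and respects the labelled edges of the induced
subgraphs in both directions. -/
def BallIso {L V W : Type*} (G : LabelledGraph L V) (x : V) (H : LabelledGraph L W) (y : W)
    (r : ℕ) : Prop :=
  ∃ e : G.ball x r ≃ H.ball y r,
    (∀ a : G.ball x r, (a : V) = x ↔ (e a : W) = y) ∧
    ∀ (s : L) (a b : G.ball x r), G.edge s a b ↔ H.edge s (e a) (e b)

/-- The Cayley graph `Cay(Γ, S)`: a directed edge labelled `s` goes from `g` to `g * s`. -/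
def cayley {Γ : Type*} [Group Γ] (S : Finset Γ) : LabelledGraph S Γ where
  edge s g h := g * (s : Γ) = h

end LabelledGraph

/-- A graph sequence: finite connected graphs of uniformly bounded degree, whose numbers of
vertices tend to infinity. -/
structure IsGraphSequence {V : ℕ → Type*} [∀ n, Finite (V n)] (G : ∀ n, SimpleGraph (V n)) :
    Prop where
  connected : ∀ n, (G n).Connected
  bounded_degree : ∃ d : ℕ, ∀ n (x : V n), ((G n).neighborSet x).ncard ≤ d
  card_tendsto : Tendsto (fun n => Nat.card (V n)) atTop atTop

/-- `G` is a sofic approximation of the group `Γ` generated by the finite set `S`: it is a graph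
sequence with edges labelled in `S` which converges to `Cay(Γ, S)` in the Benjamini-Schramm sense,
i.e. for each `r` the proportion of the vertices of `G n` whose `r`-ball is isomorphic to the
`r`-ball around the identity of `Cay(Γ, S)` tends to `1`. -/
structure IsSoficApproximation {Γ : Type*} [Group Γ] (S : Finset Γ) {V : ℕ → Type*}
    [∀ n, Finite (V n)] (G : ∀ n, LabelledGraph S (V n)) : Prop where
  isGraphSequence : IsGraphSequence (fun n => (G n).toSimpleGraph)
  tendsto_ball : ∀ r : ℕ,
    Tendsto (fun n =>
      ({x : V n | (G n).BallIso x (LabelledGraph.cayley S) 1 r}.ncard : ℝ) / Nat.card (V n))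
      atTop (𝓝 1)

/-- Property A for a sequence of graphs, connected or not.  The functions `ξ n x` lie in
`ℓ¹(V n)`, and balls are taken for the path metric of `G n`, where points in different components
are at infinite distance; the radius `R` does not depend on `n`. -/
def HasPropertyA {V : ℕ → Type*} (G : ∀ n, SimpleGraph (V n)) : Prop :=
  ∀ ε : ℝ, 0 < ε → ∃ (R : ℕ) (ξ : ∀ n, V n → lp (fun _ : V n => ℝ) 1), ∀ n,
    (∀ x, ‖ξ n x‖ = 1) ∧
    (∀ x y, ξ n x y ≠ 0 → (G n).edist x y ≤ R) ∧
    (∀ x y, (G n).Adj x y → ‖ξ n x - ξ n y‖ < ε)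

/-- Property almost-A: after deletion of a vanishing proportion of the vertices, the remaining
induced subgraphs (with their own path metrics) have property A. -/
def HasPropertyAlmostA {V : ℕ → Type*} [∀ n, Finite (V n)] (G : ∀ n, SimpleGraph (V n)) : Prop :=
  ∃ V' : ∀ n, Set (V n),
    Tendsto (fun n => ((V' n).ncard : ℝ) / Nat.card (V n)) atTop (𝓝 0) ∧
    HasPropertyA (fun n => (G n).induce (V' n)ᶜ)

/-- Hyperfiniteness of a sequence of finite graphs: for every `ε > 0` there are sets `E n` of
edges, and a bound `K` independent of `n`, such that `lim |E n| / |V n|` exists and is less than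
`ε`, and all components of `G n` without the edges of `E n` have at most `K` vertices. -/
def IsHyperfinite {V : ℕ → Type*} [∀ n, Finite (V n)] (G : ∀ n, SimpleGraph (V n)) : Prop :=
  ∀ ε : ℝ, 0 < ε → ∃ (E : ∀ n, Set (Sym2 (V n))) (K : ℕ) (l : ℝ),
    0 < K ∧ (∀ n, E n ⊆ (G n).edgeSet) ∧
    Tendsto (fun n => ((E n).ncard : ℝ) / Nat.card (V n)) atTop (𝓝 l) ∧ l < ε ∧
    ∀ n (C : ((G n).deleteEdges (E n)).ConnectedComponent), C.supp.ncard ≤ K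

open scoped Classical Pointwise in
/-- Amenability of a discrete group: for every finite `T ⊆ Γ` and `ε > 0` there is a finite
nonempty (Følner) set `F ⊆ Γ` with `|gF ∆ F| ≤ ε |F|` for all `g ∈ T`. -/
def IsAmenableGroup (Γ : Type*) [Group Γ] : Prop :=
  ∀ (T : Finset Γ) (ε : ℝ), 0 < ε → ∃ F : Finset Γ, F.Nonempty ∧
    ∀ g ∈ T, ((symmDiff (g • F) F).card : ℝ) ≤ ε * F.card

/-! Amenability is equivalent to each of the other two properties separately.

From amenability: take a finite `A ⊆ Γ` with few elements that some letter moves out of `A`. In a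
finite graph, words representing the elements of `A` define "translates" of `A` based at arbitrary
vertices. Within any set `H` of vertices with Cayley-like neighbourhoods, each vertex lies in at
least `|A|` translates but on the boundary of at most `|∂A|` of them. Averaging, for any weights on
the vertices, yields a translate with relatively light boundary (`exists_small_innerBoundary`).
Cutting off such translates greedily leaves pieces of at most `|A|` vertices after removal of a
light set (`IsAmenableGroup.exists_separator`).

Constant weights give hyperfiniteness. Having all weights available gives more: by the minimax
principle `exists_distribution_of_forall_weight` there is a random separator that contains each
vertex with small probability. Sending `x` to the law of a representative of its random piece gives
the functions required by property A. A diagonal choice of the deleted bad vertices makes one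
deletion serve all `ε`.

Towards amenability: both other properties provide a kernel `ξ` of bounded propagation that varies
little along most edges (`IsSlowKernel`). Averaging over the second variable finds `z` such that `x
↦ ξ x z` has small variation relative to its sum and is supported near a vertex with a Cayley-like
ball. One of its level sets has small boundary, and a chart carries that set to a Følner set in `Γ`.
-/

namespace LabelledGraph

/-! ### Balls and words in labelled graphs -/

variable {L V : Type*}

/-- A step from `x` to `y` along an edge with label `p.1`, followed forwards if `p.2` is `true` and
backwards otherwise. -/
def Step (G : LabelledGraph L V) (p : L × Bool) (x y : V) : Prop :=
  bif p.2 then G.edge p.1 x y else G.edge p.1 y x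

/-- The word `u` in the labels can be read along a path from `x` to `y`. -/
def Traverses (G : LabelledGraph L V) : List (L × Bool) → V → V → Prop
  | [], x, y => x = y
  | p :: u, x, z => ∃ y, G.Step p x y ∧ G.Traverses u y z

theorem toSimpleGraph_adj (G : LabelledGraph L V) {x y : V} :
    G.toSimpleGraph.Adj x y ↔ x ≠ y ∧ ∃ p, G.Step p x y := by
  simp only [toSimpleGraph, SimpleGraph.fromRel_adj, Step, Prod.exists, Bool.exists_bool,
    cond_true, cond_false, ← exists_or]
  simp only [or_comm]

theorem Step.adj_or_eq {G : LabelledGraph L V} {p : L × Bool} {x y : V} (h : G.Step p x y) :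
    G.toSimpleGraph.Adj x y ∨ x = y := by
  by_cases hxy : x = y
  · exact .inr hxy
  · exact .inl (G.toSimpleGraph_adj.2 ⟨hxy, p, h⟩)

theorem self_mem_ball (G : LabelledGraph L V) (x : V) (r : ℕ) : x ∈ G.ball x r := by
  simp [ball]

theorem mem_ball_comm {G : LabelledGraph L V} {x y : V} {r : ℕ} :
    y ∈ G.ball x r ↔ x ∈ G.ball y r := by
  simp only [ball, Set.mem_ofPred_eq, SimpleGraph.edist_comm]

theorem ball_mono (G : LabelledGraph L V) (x : V) {r r' : ℕ} (h : r ≤ r') :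
    G.ball x r ⊆ G.ball x r' :=
  fun _ hy => le_trans (show _ ≤ (r : ℕ∞) from hy) (by exact_mod_cast h)

theorem mem_ball_trans {G : LabelledGraph L V} {x y z : V} {r r' : ℕ} (h : y ∈ G.ball x r)
    (h' : z ∈ G.ball y r') : z ∈ G.ball x (r + r') := by
  simp only [ball, Set.mem_ofPred_eq] at *
  push_cast
  exact SimpleGraph.edist_triangle.trans (add_le_add h h')

theorem Step.mem_ball_one {G : LabelledGraph L V} {p : L × Bool} {x y : V} (h : G.Step p x y) :
    y ∈ G.ball x 1 := by
  simpa [ball, SimpleGraph.edist_le_one_iff_adj_or_eq] using h.adj_or_eq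

theorem Traverses.mem_ball {G : LabelledGraph L V} {u : List (L × Bool)} :
    ∀ {x y : V}, G.Traverses u x y → y ∈ G.ball x u.length := by
  induction u with
  | nil => rintro x y rfl; exact G.self_mem_ball _ _
  | cons p u ih =>
    rintro x z ⟨y, hxy, hyz⟩
    rw [List.length_cons, add_comm]
    exact mem_ball_trans hxy.mem_ball_one (ih hyz)

theorem exists_of_mem_ball_succ {G : LabelledGraph L V} {x y : V} {r : ℕ}
    (h : y ∈ G.ball x (r + 1)) :
    y ∈ G.ball x r ∨ ∃ z ∈ G.ball x r, ∃ p, G.Step p z y := by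
  simp only [ball, Set.mem_ofPred_eq] at h ⊢
  rw [or_iff_not_imp_left]
  intro hr
  obtain ⟨w, hw⟩ := SimpleGraph.exists_walk_of_edist_ne_top
    (ne_top_of_le_ne_top (ENat.natCast_ne_top (r + 1)) h)
  rw [← hw] at h hr
  rw [Nat.cast_le] at h hr
  have hnil : ¬ w.Nil := by
    intro hn
    have := SimpleGraph.Walk.length_eq_zero_iff.2 hn
    omega
  refine ⟨w.penultimate, ?_, ?_⟩
  · refine (SimpleGraph.edist_le w.dropLast).trans ?_
    rw [Nat.cast_le]
    have := w.length_dropLast_add_one hnil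
    omega
  · exact (G.toSimpleGraph_adj.1 (w.adj_penultimate hnil)).2

/-! ### Charts onto balls of the Cayley graph -/

section Chart

variable {Γ : Type*} [Group Γ] {S : Finset Γ}

/-- The group element of a letter. -/
def letterVal (p : S × Bool) : Γ := bif p.2 then (p.1 : Γ) else (p.1 : Γ)⁻¹

/-- The group element of a word. -/
def wordVal (u : List (S × Bool)) : Γ := (u.map letterVal).prod

theorem cayley_step {p : S × Bool} {g h : Γ} :
    (cayley S).Step p g h ↔ g * letterVal p = h := by
  obtain ⟨s, b⟩ := p
  cases b
  · simp only [Step, cayley, letterVal, cond_false, mul_inv_eq_iff_eq_mul]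
    exact eq_comm
  · simp [Step, cayley, letterVal]

theorem cayley_traverses {u : List (S × Bool)} :
    ∀ {g h : Γ}, (cayley S).Traverses u g h ↔ g * wordVal u = h := by
  induction u with
  | nil => simp [Traverses, wordVal]
  | cons p u ih =>
    intro g h
    simp only [Traverses, cayley_step, ih, exists_eq_left', wordVal, List.map_cons, List.prod_cons,
      mul_assoc]

theorem exists_wordVal_eq (hS : Subgroup.closure (S : Set Γ) = ⊤) (g : Γ) :
    ∃ u : List (S × Bool), wordVal u = g := by
  have hg : g ∈ Subgroup.closure (S : Set Γ) := hS ▸ Subgroup.mem_top g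
  induction hg using Subgroup.closure_induction_left with
  | one => exact ⟨[], rfl⟩
  | mul_left s hs y _ ih =>
    obtain ⟨u, rfl⟩ := ih
    exact ⟨(⟨s, hs⟩, true) :: u, by simp [wordVal, letterVal]⟩
  | inv_mul_cancel s hs y _ ih =>
    obtain ⟨u, rfl⟩ := ih
    exact ⟨(⟨s, hs⟩, false) :: u, by simp [wordVal, letterVal]⟩

/-- `f` identifies the `r`-ball around `x` with the `r`-ball around the identity of the Cayley
graph. -/
structure IsChart (G : LabelledGraph S V) (x : V) (r : ℕ) (f : V → Γ) : Prop where
  map_root : f x = 1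
  injOn : Set.InjOn f (G.ball x r)
  step_iff : ∀ {a b}, a ∈ G.ball x r → b ∈ G.ball x r → ∀ p,
    (G.Step p a b ↔ f a * letterVal p = f b)
  mem_ball : ∀ {ρ : ℕ}, ρ ≤ r → ∀ {a}, a ∈ G.ball x ρ → f a ∈ (cayley S).ball 1 ρ
  surjOn : ∀ {ρ : ℕ}, ρ ≤ r → ∀ {g}, g ∈ (cayley S).ball 1 ρ → ∃ a ∈ G.ball x ρ, f a = g

/-- The isomorphism is only given on the full `r`-ball. The smaller concentric balls correspond as
well, by induction on the radius, since the last edge of a geodesic from the root stays inside the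
ball. -/
theorem BallIso.exists_isChart {G : LabelledGraph S V} {x : V} {r : ℕ}
    (h : G.BallIso x (cayley S) 1 r) : ∃ f, G.IsChart x r f := by
  classical
  obtain ⟨e, hroot, hedge⟩ := h
  let f : V → Γ := fun a => if ha : a ∈ G.ball x r then (e ⟨a, ha⟩ : Γ) else 1
  have hf : ∀ a (ha : a ∈ G.ball x r), f a = e ⟨a, ha⟩ := fun a ha => dif_pos ha
  have hx : f x = 1 := by
    rw [hf x (G.self_mem_ball x r)]
    exact (hroot ⟨x, _⟩).1 rfl
  have hstep : ∀ {a b}, a ∈ G.ball x r → b ∈ G.ball x r → ∀ p,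
      (G.Step p a b ↔ (cayley S).Step p (f a) (f b)) := by
    rintro a b ha hb ⟨s, _ | _⟩
    · simpa only [Step, hf a ha, hf b hb, cond_false] using hedge s ⟨b, hb⟩ ⟨a, ha⟩
    · simpa only [Step, hf a ha, hf b hb, cond_true] using hedge s ⟨a, ha⟩ ⟨b, hb⟩
  have hsurj : ∀ g ∈ (cayley S).ball 1 r, ∃ a ∈ G.ball x r, f a = g := fun g hg =>
    ⟨e.symm ⟨g, hg⟩, (e.symm ⟨g, hg⟩).2, by rw [hf _ (e.symm ⟨g, hg⟩).2]; simp⟩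
  refine ⟨f, hx, ?_, fun ha hb p => (hstep ha hb p).trans cayley_step, ?_, ?_⟩
  · intro a ha b hb hab
    rw [hf a ha, hf b hb] at hab
    exact congrArg Subtype.val (e.injective (Subtype.ext hab))
  · intro ρ
    induction ρ with
    | zero =>
      intro _ a ha
      have hax : a = x := by simpa [ball] using ha
      rw [hax, hx]; exact self_mem_ball _ _ _
    | succ ρ ih =>
      intro hρ a ha
      rcases exists_of_mem_ball_succ ha with ha' | ⟨b, hb, p, hp⟩
      · exact ball_mono _ _ ρ.le_succ (ih (by omega) ha')
      · exact mem_ball_trans (ih (by omega) hb)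
          ((hstep (G.ball_mono _ (by omega) hb) (G.ball_mono _ hρ ha) p).1 hp).mem_ball_one
  · intro ρ
    induction ρ with
    | zero =>
      intro _ g hg
      have hg : g = 1 := by simpa [ball] using hg
      exact ⟨x, self_mem_ball _ _ _, hx.trans hg.symm⟩
    | succ ρ ih =>
      intro hρ g hg
      rcases exists_of_mem_ball_succ hg with hg' | ⟨h, hh, p, hp⟩
      · obtain ⟨a, ha, rfl⟩ := ih (by omega) hg'
        exact ⟨a, G.ball_mono _ ρ.le_succ ha, rfl⟩
      · obtain ⟨b, hb, rfl⟩ := ih (by omega) hh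
        obtain ⟨a, ha, rfl⟩ := hsurj g (ball_mono _ _ hρ hg)
        exact ⟨a, mem_ball_trans hb
          ((hstep (G.ball_mono _ (by omega) hb) ha p).2 hp).mem_ball_one, rfl⟩

namespace IsChart

variable {G : LabelledGraph S V} {x : V} {r : ℕ} {f : V → Γ}

theorem map_traverses (hf : G.IsChart x r f) {u : List (S × Bool)} :
    ∀ {ρ : ℕ} {a b : V}, ρ + u.length ≤ r → a ∈ G.ball x ρ → G.Traverses u a b →
      f a * wordVal u = f b := by
  induction u with
  | nil => rintro ρ a b - - rfl; simp [wordVal]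
  | cons p u ih =>
    rintro ρ a c hr ha ⟨b, hab, hbc⟩
    rw [List.length_cons] at hr
    have hb : b ∈ G.ball x (ρ + 1) := mem_ball_trans ha hab.mem_ball_one
    rw [← ih (by omega) hb hbc, ← (hf.step_iff (G.ball_mono _ (by omega) ha)
      (G.ball_mono _ (by omega) hb) p).1 hab]
    simp [wordVal, mul_assoc]

/-- The bound `ρ + u.length ≤ r` keeps every intermediate group element in the ball covered by the
chart, so the path in the Cayley graph lifts letter by letter. -/
theorem traverses_of_map (hf : G.IsChart x r f) {u : List (S × Bool)} :
    ∀ {ρ : ℕ} {a b : V}, ρ + u.length ≤ r → a ∈ G.ball x ρ → b ∈ G.ball x r →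
      f a * wordVal u = f b → G.Traverses u a b := by
  induction u with
  | nil =>
    intro ρ a b hr ha hb h
    simp only [wordVal, List.map_nil, List.prod_nil, mul_one] at h
    exact hf.injOn (G.ball_mono _ (by simpa using hr) ha) hb h
  | cons p u ih =>
    intro ρ a c hr ha hc h
    rw [List.length_cons] at hr
    have hmem : f a * letterVal p ∈ (cayley S).ball 1 (ρ + 1) :=
      mem_ball_trans (hf.mem_ball (by omega) ha) (cayley_step (p := p).2 rfl).mem_ball_one
    obtain ⟨b, hb, hfb⟩ := hf.surjOn (by omega) hmem
    refine ⟨b, (hf.step_iff (G.ball_mono _ (by omega) ha) (G.ball_mono _ (by omega) hb) p).2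
      hfb.symm, ih (by omega) hb hc ?_⟩
    rw [hfb, ← h]
    simp [wordVal, mul_assoc]

end IsChart

end Chart

end LabelledGraph

/-! ### Følner sets and translates with light boundary -/

open scoped Classical Pointwise in
/-- Følner sets for right multiplication by the letters. -/
theorem IsAmenableGroup.exists_right_folner {Γ : Type*} [Group Γ] (hΓ : IsAmenableGroup Γ)
    (S : Finset Γ) {ε : ℝ} (hε : 0 < ε) :
    ∃ A : Finset Γ, A.Nonempty ∧
      ((A.filter fun a => ∃ p : S × Bool, a * LabelledGraph.letterVal p ∉ A).card : ℝ)
        ≤ ε * A.card := by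
  set N : ℝ := (Fintype.card (S × Bool) : ℝ) with hN
  have hN0 : 0 ≤ N := by positivity
  obtain ⟨F, hF, hFT⟩ := hΓ (Finset.univ.image (LabelledGraph.letterVal (S := S)))
    (ε / (N + 1)) (by positivity)
  refine ⟨F.image (·⁻¹), hF.image _, ?_⟩
  rw [Finset.card_image_of_injective _ inv_injective]
  have hsub : (F.image (·⁻¹)).filter
      (fun a => ∃ p : S × Bool, a * LabelledGraph.letterVal p ∉ F.image (·⁻¹)) ⊆
      Finset.univ.biUnion fun p : S × Bool =>
        (symmDiff (LabelledGraph.letterVal p • F) F).image (·⁻¹) := by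
    intro a ha
    simp only [Finset.mem_filter, Finset.mem_image] at ha
    obtain ⟨⟨b, hb, rfl⟩, p, hp⟩ := ha
    refine Finset.mem_biUnion.2 ⟨p, Finset.mem_univ _, Finset.mem_image_of_mem _ ?_⟩
    refine Finset.mem_symmDiff.2 (.inr ⟨hb, fun hb' => hp ?_⟩)
    obtain ⟨c, hc, hcb⟩ := Finset.mem_smul_finset.1 hb'
    refine ⟨c, hc, ?_⟩
    rw [← hcb, smul_eq_mul]
    group
  calc _ ≤ ((Finset.univ.biUnion fun p : S × Bool =>
        (symmDiff (LabelledGraph.letterVal p • F) F).image (·⁻¹)).card : ℝ) := by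
        exact_mod_cast Finset.card_le_card hsub
    _ ≤ ∑ p : S × Bool, ((symmDiff (LabelledGraph.letterVal p • F) F).card : ℝ) := by
        refine le_trans (Nat.cast_le.2 Finset.card_biUnion_le) ?_
        push_cast
        exact Finset.sum_le_sum fun p _ => Nat.cast_le.2 Finset.card_image_le
    _ ≤ ∑ _p : S × Bool, ε / (N + 1) * F.card :=
        Finset.sum_le_sum fun p _ => hFT _ (Finset.mem_image_of_mem _ (Finset.mem_univ p))
    _ = N / (N + 1) * (ε * F.card) := by
        rw [Finset.sum_const, nsmul_eq_mul, Finset.card_univ, ← hN]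
        ring
    _ ≤ 1 * (ε * F.card) := by
        gcongr
        rw [div_le_one (by positivity)]
        linarith
    _ = _ := one_mul _

namespace SimpleGraph

open scoped Classical in
/-- The vertices of `D` that have a neighbour in `H` outside `D`. -/
noncomputable def innerBoundary {V : Type*} (G : SimpleGraph V) (H D : Finset V) : Finset V :=
  D.filter fun y => ∃ z ∈ H, G.Adj y z ∧ z ∉ D

theorem mem_innerBoundary {V : Type*} {G : SimpleGraph V} {H D : Finset V} {y : V} :
    y ∈ G.innerBoundary H D ↔ y ∈ D ∧ ∃ z ∈ H, G.Adj y z ∧ z ∉ D := by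
  simp [innerBoundary]

theorem innerBoundary_subset {V : Type*} (G : SimpleGraph V) (H D : Finset V) :
    G.innerBoundary H D ⊆ D :=
  fun _ h => (mem_innerBoundary.1 h).1

end SimpleGraph

namespace LabelledGraph

variable {Γ V : Type*} [Group Γ] {S : Finset Γ} [Fintype V]

-- Double counting over the translates `D x`, with `x` ranging over all vertices. The base point `x`
-- need not have a good ball: every argument uses a chart centred at a point of `H` within distance
-- `ℓ` of `x`. Radius `2 * ℓ` covers the whole translate, and the extra `1` ensures that neighbours
-- of the centre are covered even if `ℓ = 0`.
open scoped Classical in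
theorem exists_small_innerBoundary (G : LabelledGraph S V) {A : Finset Γ} (hA : A.Nonempty) {ε : ℝ}
    (hAε : ((A.filter fun a => ∃ p : S × Bool, a * letterVal p ∉ A).card : ℝ) ≤ ε * A.card)
    {u : Γ → List (S × Bool)} (hu : ∀ a, wordVal (u a) = a) {ℓ : ℕ}
    (hℓ : ∀ a ∈ A, (u a).length ≤ ℓ) {H : Finset V}
    (hH : ∀ y ∈ H, ∃ f, G.IsChart y (2 * ℓ + 1) f) {w : V → ℝ} (hw : ∀ x, 0 ≤ w x)
    (hwH : 0 < ∑ x ∈ H, w x) :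
    ∃ D ⊆ H, D.Nonempty ∧ D.card ≤ A.card ∧
      ∑ y ∈ G.toSimpleGraph.innerBoundary H D, w y ≤ ε * ∑ y ∈ D, w y := by
  choose! f hf using hH
  let D : V → Finset V := fun x => H.filter fun z => ∃ a ∈ A, G.Traverses (u a) x z
  let B : V → Finset V := fun x => G.toSimpleGraph.innerBoundary H (D x)
  have mem_D : ∀ {x z}, z ∈ D x ↔ z ∈ H ∧ ∃ a ∈ A, G.Traverses (u a) x z := fun {x z} => by
    simp [D]
  have near : ∀ {x z a}, a ∈ A → G.Traverses (u a) x z → x ∈ G.ball z ℓ := fun ha h =>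
    mem_ball_comm.1 (G.ball_mono _ (hℓ _ ha) h.mem_ball)
  have rel : ∀ {y}, y ∈ H → ∀ {x z a}, a ∈ A → x ∈ G.ball y ℓ → G.Traverses (u a) x z →
      f y x * a = f y z := fun {y} hy {x z a} ha hx h => by
    have := (hf y hy).map_traverses (by have := hℓ a ha; omega) hx h
    rwa [hu] at this
  have hcard : ∀ x, (D x).card ≤ A.card := by
    intro x
    rcases (D x).eq_empty_or_nonempty with h0 | ⟨z₀, hz₀⟩
    · simp [h0]
    obtain ⟨hz₀H, a₀, ha₀, h₀⟩ := mem_D.1 hz₀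
    have hx := near ha₀ h₀
    have hzx : ∀ z ∈ D x, z ∈ G.ball z₀ (2 * ℓ + 1) := fun z hz => by
      obtain ⟨-, a, ha, h⟩ := mem_D.1 hz
      exact G.ball_mono _ (by omega) (mem_ball_trans hx (mem_ball_comm.1 (near ha h)))
    refine Finset.card_le_card_of_injOn (fun z => (f z₀ x)⁻¹ * f z₀ z) ?_ ?_
    · intro z hz
      obtain ⟨-, a, ha, h⟩ := mem_D.1 hz
      simpa [← rel hz₀H ha hx h] using ha
    · intro z hz z' hz' h
      exact (hf z₀ hz₀H).injOn (hzx z hz) (hzx z' hz') (mul_left_cancel h)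
  -- In the chart at `y`, the base points at `a⁻¹`, for `a ∈ A`, are distinct and their translates
  -- contain `y`.
  have hlow : ∀ y ∈ H, A.card ≤ (Finset.univ.filter fun x => y ∈ D x).card := by
    intro y hy
    have : Nonempty V := ⟨y⟩
    have : ∀ a ∈ A, ∃ x ∈ G.ball y ℓ, f y x = a⁻¹ := fun a ha => by
      refine (hf y hy).surjOn (by omega) (ball_mono _ _ (hℓ a ha) (mem_ball_comm.1 ?_))
      exact Traverses.mem_ball (cayley_traverses.2 (by rw [hu, inv_mul_cancel]))
    choose! g hg hfg using this
    refine Finset.card_le_card_of_injOn g ?_ ?_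
    · intro a ha
      have ha : a ∈ A := ha
      have : G.Traverses (u a) (g a) y :=
        (hf y hy).traverses_of_map (ρ := ℓ) (by have := hℓ a ha; omega) (hg a ha)
          (G.self_mem_ball _ _) (by rw [hu, hfg a ha, (hf y hy).map_root, inv_mul_cancel])
      simpa using mem_D.2 ⟨hy, a, ha, this⟩
    · intro a ha b hb hab
      rw [← inv_inj, ← hfg a ha, ← hfg b hb, hab]
  -- If `y` is reached from `x` by `a` and has a neighbour in `H` outside `D x`, then the letter of
  -- that edge moves `a` out of `A`; moreover `a` determines `x`.
  have hup : ∀ y ∈ H, (Finset.univ.filter fun x => y ∈ B x).card ≤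
      (A.filter fun a => ∃ p : S × Bool, a * letterVal p ∉ A).card := by
    intro y hy
    have key : ∀ x, y ∈ B x → x ∈ G.ball y ℓ ∧ (f y x)⁻¹ ∈
        A.filter fun a => ∃ p : S × Bool, a * letterVal p ∉ A := by
      intro x hx
      simp only [B, SimpleGraph.mem_innerBoundary] at hx
      obtain ⟨hyD, y', hy', hadj, hyD'⟩ := hx
      obtain ⟨-, a, ha, h⟩ := mem_D.1 hyD
      have hxy := near ha h
      have hax : f y x * a = 1 := (rel hy ha hxy h).trans (hf y hy).map_root
      rw [inv_eq_of_mul_eq_one_right hax]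
      refine ⟨hxy, Finset.mem_filter.2 ⟨ha, ?_⟩⟩
      obtain ⟨p, hp⟩ := (G.toSimpleGraph_adj.1 hadj).2
      refine ⟨p, fun hap => hyD' (mem_D.2 ⟨hy', _, hap, ?_⟩)⟩
      have hy'1 : y' ∈ G.ball y (2 * ℓ + 1) := G.ball_mono _ (by omega) hp.mem_ball_one
      refine (hf y hy).traverses_of_map (ρ := ℓ) (by have := hℓ _ hap; omega) hxy hy'1 ?_
      rw [hu, ← mul_assoc, hax, ← (hf y hy).map_root]
      exact ((hf y hy).step_iff (G.self_mem_ball _ _) hy'1 p).1 hp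
    refine Finset.card_le_card_of_injOn (fun x => (f y x)⁻¹) ?_ ?_
    · intro x hx
      exact (key x (by simpa using hx)).2
    · intro x hx x' hx' h
      exact (hf y hy).injOn (G.ball_mono _ (by omega) (key x (by simpa using hx)).1)
        (G.ball_mono _ (by omega) (key x' (by simpa using hx')).1) (inv_injective h)
  have hcount : ∀ E : V → Finset V, (∀ x, E x ⊆ H) → ∑ x, ∑ y ∈ E x, w y =
      ∑ y ∈ H, w y * (Finset.univ.filter fun x => y ∈ E x).card := by
    intro E hE
    rw [Finset.sum_comm' (t' := H) (s' := fun y => Finset.univ.filter fun x => y ∈ E x)]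
    · simp [mul_comm]
    · intro x y
      simp only [Finset.mem_univ, true_and, Finset.mem_filter]
      exact ⟨fun h => ⟨h, hE x h⟩, fun h => h.1⟩
  have hDH : ∀ x, D x ⊆ H := fun x => Finset.filter_subset _ _
  have hBD : ∀ x, B x ⊆ D x := fun x => G.toSimpleGraph.innerBoundary_subset H (D x)
  have hpos : 0 < ∑ x, ∑ y ∈ D x, w y := by
    rw [hcount D hDH]
    refine lt_of_lt_of_le (mul_pos hwH (Nat.cast_pos.2 hA.card_pos)) ?_
    rw [Finset.sum_mul]
    exact Finset.sum_le_sum fun y hy => mul_le_mul_of_nonneg_left (Nat.cast_le.2 (hlow y hy)) (hw y)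
  have hε : 0 ≤ ε := by
    have := (Nat.cast_nonneg _).trans hAε
    exact nonneg_of_mul_nonneg_left this (Nat.cast_pos.2 hA.card_pos)
  have htotal : ∑ x, ∑ y ∈ B x, w y ≤ ∑ x, ε * ∑ y ∈ D x, w y := by
    rw [← Finset.mul_sum, hcount B fun x => (hBD x).trans (hDH x), hcount D hDH, Finset.mul_sum]
    refine Finset.sum_le_sum fun y hy => ?_
    calc _ ≤ w y * (ε * A.card) := by
          refine mul_le_mul_of_nonneg_left (le_trans ?_ hAε) (hw y)
          exact_mod_cast hup y hy
      _ = ε * (w y * A.card) := by ring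
      _ ≤ _ := by
          refine mul_le_mul_of_nonneg_left (mul_le_mul_of_nonneg_left ?_ (hw y)) hε
          exact_mod_cast hlow y hy
  by_contra! hcon
  refine absurd htotal (not_le.2 ?_)
  -- Empty translates give equality, so the strict contradiction needs one nonempty translate.
  obtain ⟨x₀, -, hx₀⟩ := Finset.exists_lt_of_sum_lt
    (show ∑ _x : V, (0 : ℝ) < ∑ x, ∑ y ∈ D x, w y by simpa using hpos)
  have hne : ∀ x, (D x).Nonempty → ε * ∑ y ∈ D x, w y < ∑ y ∈ B x, w y :=
    fun x hx => hcon (D x) (hDH x) hx (hcard x)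
  refine Finset.sum_lt_sum (fun x _ => ?_) ⟨x₀, Finset.mem_univ _, hne x₀ ?_⟩
  · rcases (D x).eq_empty_or_nonempty with h | h
    · rw [h, Finset.sum_empty, mul_zero]
      exact Finset.sum_nonneg fun y _ => hw y
    · exact (hne x h).le
  · by_contra h
    rw [Finset.not_nonempty_iff_eq_empty] at h
    simp [h] at hx₀

end LabelledGraph

/-! ### Separators for arbitrary weights -/

namespace SimpleGraph

variable {V : Type*}

/-- The vertices of `W` are distributed over sets with at most `K` elements, and no edge inside `W`
joins different ones of these sets. -/
def HasSmallPieces (G : SimpleGraph V) (W : Set V) (K : ℕ) : Prop :=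
  ∃ c : V → Finset V, (∀ x ∈ W, x ∈ c x ∧ (c x).card ≤ K) ∧
    ∀ x ∈ W, ∀ y ∈ W, G.Adj x y → c x = c y

/-- Greedy decomposition: cut `D` out of `H`, pay for its inner boundary, and continue in `H \ D`.
The payments are charged to disjoint sets `D`, so they add up to at most `ε` times the weight of
`H`. -/
theorem exists_separator_of_innerBoundary (G : SimpleGraph V) {w : V → ℝ}
    (hw : ∀ x, 0 ≤ w x) {ε : ℝ} {K : ℕ} {X : Finset V}
    (hX : ∀ H ⊆ X, 0 < ∑ x ∈ H, w x → ∃ D ⊆ H, D.Nonempty ∧ D.card ≤ K ∧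
      ∑ y ∈ G.innerBoundary H D, w y ≤ ε * ∑ y ∈ D, w y) (H : Finset V) (hH : H ⊆ X) :
    ∃ Z ⊆ H, ∑ x ∈ Z, w x ≤ ε * ∑ x ∈ H, w x ∧ G.HasSmallPieces (H \ Z) K := by
  classical
  simp only [← Finset.coe_sdiff]
  induction H using Finset.strongInduction with
  | H H ih =>
  rcases (Finset.sum_nonneg fun x _ => hw x : 0 ≤ ∑ x ∈ H, w x).eq_or_lt with h0 | hpos
  -- A set of weight zero can be removed entirely at no cost.
  · exact ⟨H, subset_rfl, by simp [← h0], fun _ => ∅, by simp, by simp⟩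
  obtain ⟨D, hDH, hD, hDK, hDw⟩ := hX H hH hpos
  obtain ⟨Z, hZ, hZw, c, hcK, hc⟩ :=
    ih (H \ D) (Finset.sdiff_ssubset hDH hD) (Finset.sdiff_subset.trans hH)
  have hBD : G.innerBoundary H D ⊆ D := G.innerBoundary_subset H D
  have hsplit : ∀ x, x ∈ H \ (Z ∪ G.innerBoundary H D) →
      (x ∈ D ∧ x ∉ G.innerBoundary H D) ∨ (x ∉ D ∧ x ∈ (H \ D) \ Z) := by
    intro x hx
    simp only [Finset.mem_sdiff, Finset.mem_union, not_or] at hx ⊢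
    tauto
  have hcross : ∀ x y, x ∈ D → x ∉ G.innerBoundary H D → y ∈ H → G.Adj x y → y ∈ D := by
    intro x y hx hxB hy hxy
    by_contra hyD
    exact hxB (mem_innerBoundary.2 ⟨hx, y, hy, hxy, hyD⟩)
  refine ⟨Z ∪ G.innerBoundary H D,
    Finset.union_subset (hZ.trans Finset.sdiff_subset) (hBD.trans hDH), ?_,
    fun x => if x ∈ D then D else c x, ?_, ?_⟩
  · rw [Finset.sum_union (Finset.disjoint_of_subset_left hZ
      (Finset.disjoint_of_subset_right hBD Finset.sdiff_disjoint)), ← Finset.sum_sdiff hDH]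
    linarith
  · intro x hx
    rcases hsplit x hx with ⟨h, -⟩ | ⟨h, h'⟩
    · simpa [h] using hDK
    · simpa [h] using hcK x h'
  · intro x hx y hy hxy
    have hxH := (Finset.mem_sdiff.1 hx).1
    have hyH := (Finset.mem_sdiff.1 hy).1
    rcases hsplit x hx with ⟨h, hB⟩ | ⟨h, h'⟩ <;> rcases hsplit y hy with ⟨k, kB⟩ | ⟨k, k'⟩
    · simp [h, k]
    · exact absurd (hcross x y h hB hyH hxy) k
    · exact absurd (hcross y x k kB hxH hxy.symm) h
    · simpa [h, k] using hc x h' y k' hxy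

/-- Whatever the weights of the vertices, a set of at most `ε` times the total weight can be removed
so that only pieces with at most `K` vertices are left. -/
def IsWeightedHyperfinite [Fintype V] (G : SimpleGraph V) (ε : ℝ) (K : ℕ) : Prop :=
  ∀ w : V → ℝ, (∀ x, 0 ≤ w x) →
    ∃ Z : Finset V, ∑ x ∈ Z, w x ≤ ε * ∑ x, w x ∧ G.HasSmallPieces (Z : Set V)ᶜ K

theorem isWeightedHyperfinite_of_card_le [Fintype V] (G : SimpleGraph V) {ε : ℝ} (hε : 0 ≤ ε)
    {K : ℕ} (hK : Fintype.card V ≤ K) : G.IsWeightedHyperfinite ε K := fun w hw =>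
  ⟨∅, by simpa using mul_nonneg hε (Finset.sum_nonneg fun x _ => hw x),
    fun _ => Finset.univ, fun x _ => ⟨Finset.mem_univ x, hK⟩, fun _ _ _ _ _ => rfl⟩

theorem IsWeightedHyperfinite.mono [Fintype V] {G : SimpleGraph V} {ε : ℝ} {K K' : ℕ}
    (h : G.IsWeightedHyperfinite ε K) (hK : K ≤ K') : G.IsWeightedHyperfinite ε K' := fun w hw => by
  obtain ⟨Z, hZ, c, hc, hc'⟩ := h w hw
  exact ⟨Z, hZ, c, fun x hx => ⟨(hc x hx).1, (hc x hx).2.trans hK⟩, hc'⟩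

theorem isWeightedHyperfinite_induce (G : SimpleGraph V) {X : Set V} [Fintype X]
    {ε : ℝ} {K : ℕ}
    (h : ∀ w : V → ℝ, (∀ x, 0 ≤ w x) → ∃ Z ⊆ X.toFinset, ∑ x ∈ Z, w x ≤ ε * ∑ x ∈ X.toFinset, w x ∧
      G.HasSmallPieces (X.toFinset \ Z) K) :
    (G.induce X).IsWeightedHyperfinite ε K := by
  classical
  intro w hw
  obtain ⟨Z, hZX, hZ, c, hcK, hc⟩ := h (fun v => if hv : v ∈ X then w ⟨v, hv⟩ else 0) (fun v => by
    split_ifs <;> simp [hw])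
  have hmem : ∀ x : X, x ∈ ((Z.subtype (· ∈ X) : Finset X) : Set X)ᶜ →
      (x : V) ∈ (X.toFinset \ Z : Set V) := by
    intro x hx
    simpa using hx
  refine ⟨Z.subtype (· ∈ X), ?_, fun x => (c x).subtype (· ∈ X), ?_, ?_⟩
  · have h1 : ∑ x ∈ Z.subtype (· ∈ X), w x =
        ∑ v ∈ Z, if hv : v ∈ X then w ⟨v, hv⟩ else 0 := by
      rw [← Finset.sum_subtype_of_mem (p := (· ∈ X)) _ fun v hv => by simpa using hZX hv]
      exact Finset.sum_congr rfl fun x _ => by simp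
    have h2 : ∑ x, w x = ∑ v ∈ X.toFinset, if hv : v ∈ X then w ⟨v, hv⟩ else 0 := by
      rw [← Finset.sum_subtype_of_mem (p := (· ∈ X)) _ fun v hv => by simpa using hv]
      exact Finset.sum_congr (by ext; simp) fun x _ => by simp
    rw [h1, h2]
    exact hZ
  · intro x hx
    obtain ⟨h1, h2⟩ := hcK x (hmem x hx)
    refine ⟨by simpa using h1, le_trans ?_ h2⟩
    rw [Finset.card_subtype]
    exact Finset.card_filter_le _ _
  · intro x hx y hy hxy
    simp only [hc x (hmem x hx) y (hmem y hy) hxy]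

/-- A path from `x` stays in `c x` and does not repeat vertices, so it has at most `K + 1` vertices
and hence at most `K` edges. -/
theorem eq_and_edist_le_of_reachable {G : SimpleGraph V} {c : V → Finset V} {K : ℕ}
    (hc : ∀ x, x ∈ c x) (hK : ∀ x, (c x).card ≤ K + 1) (hadj : ∀ x y, G.Adj x y → c x = c y)
    {x y : V} (h : G.Reachable x y) : c x = c y ∧ G.edist x y ≤ K := by
  classical
  have hwalk : ∀ {x y : V}, G.Walk x y → c x = c y := fun p => by
    induction p with
    | nil => rfl
    | cons h _ ih => exact (hadj _ _ h).trans ih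
  obtain ⟨p⟩ := h
  refine ⟨hwalk p, (edist_le (p.toPath : G.Walk x y)).trans ?_⟩
  have hp : (p.toPath : G.Walk x y).IsPath := p.toPath.2
  have hsub : (p.toPath : G.Walk x y).support.toFinset ⊆ c x := by
    intro z hz
    rw [List.mem_toFinset] at hz
    rw [hwalk ((p.toPath : G.Walk x y).takeUntil z hz)]
    exact hc z
  have := (Finset.card_le_card hsub).trans (hK x)
  rw [List.toFinset_card_of_nodup hp.support_nodup, Walk.length_support] at this
  exact_mod_cast Nat.le_of_succ_le_succ this

/-- Representatives of the components of a subgraph with small components. -/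
theorem exists_representatives {G G' : SimpleGraph V} (hG : G' ≤ G) {c : V → Finset V} {K : ℕ}
    (hc : ∀ x, x ∈ c x) (hK : ∀ x, (c x).card ≤ K + 1) (hadj : ∀ x y, G'.Adj x y → c x = c y) :
    ∃ ρ : V → V, (∀ x, G.edist x (ρ x) ≤ K) ∧ ∀ x y, G'.Adj x y → ρ x = ρ y := by
  refine ⟨fun x => (G'.connectedComponentMk x).out, fun x => ?_, fun x y hxy => ?_⟩
  · refine (edist_anti hG).trans (eq_and_edist_le_of_reachable hc hK hadj ?_).2
    exact ConnectedComponent.exact (Quot.out_eq (G'.connectedComponentMk x)).symm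
  · simp only [ConnectedComponent.sound hxy.reachable]

end SimpleGraph

/-! ### Random separators and property A -/

/-- A minimax principle: if for all weights some `Z i` has at most `ε` times the total weight, then
a random `Z i` contains each given point with probability at most `ε`. -/
theorem exists_distribution_of_forall_weight {ι V : Type*} [Fintype ι] [Fintype V] [DecidableEq V]
    (Z : ι → Finset V) {ε : ℝ}
    (h : ∀ w : V → ℝ, (∀ x, 0 ≤ w x) → ∃ i, ∑ x ∈ Z i, w x ≤ ε * ∑ x, w x) :
    ∃ π ∈ stdSimplex ℝ ι, ∀ v, ∑ i, (if v ∈ Z i then π i else 0) ≤ ε := by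
  classical
  let T : (ι → ℝ) →ₗ[ℝ] (V → ℝ) :=
    { toFun := fun π v => ∑ i, if v ∈ Z i then π i else 0
      map_add' := fun π π' => by
        ext v
        simp only [Pi.add_apply, ← Finset.sum_add_distrib]
        exact Finset.sum_congr rfl fun i _ => by split_ifs <;> simp
      map_smul' := fun a π => by
        ext v
        simp [Finset.mul_sum] }
  by_contra! hcon
  -- If no distribution works, the compact convex set of hitting-probability vectors misses the
  -- closed convex set of vectors bounded by `ε`; a separating functional then supplies the
  -- offending weights.
  have hdisj : Disjoint (T '' stdSimplex ℝ ι) {z | ∀ v, z v ≤ ε} := by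
    rw [Set.disjoint_left]
    rintro _ ⟨π, hπ, rfl⟩ hz
    obtain ⟨v, hv⟩ := hcon π hπ
    exact absurd (hz v) (not_le.2 hv)
  obtain ⟨f, a, b, hfa, hab, hfb⟩ := geometric_hahn_banach_compact_closed
    ((convex_stdSimplex ℝ ι).linear_image T)
    ((isCompact_stdSimplex ℝ ι).image T.continuous_of_finiteDimensional)
    (by
      intro x hx y hy s t hs ht hst v
      calc s * x v + t * y v ≤ s * ε + t * ε := by
            gcongr
            · exact hx v
            · exact hy v
        _ = ε := by rw [← add_mul, hst, one_mul])
    (by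
      simp only [Set.ofPred_forall]
      exact isClosed_iInter fun v => isClosed_le (continuous_apply v) continuous_const)
    hdisj
  let φ : V → ℝ := fun v => f (Pi.single v 1)
  have hf : ∀ z : V → ℝ, f z = ∑ v, z v * φ v := fun z => by
    conv_lhs => rw [← Finset.univ_sum_single z]
    rw [map_sum]
    refine Finset.sum_congr rfl fun v _ => ?_
    rw [← smul_eq_mul, ← map_smul, ← Pi.single_smul', smul_eq_mul, mul_one]
  have hconst : b < f fun _ => ε := hfb _ fun _ => le_rfl
  -- The functional is bounded below on a set whose coordinates may tend to `-∞`, so its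
  -- coefficients are nonpositive and `-φ` is an admissible weight.
  have hφ : ∀ v, φ v ≤ 0 := by
    intro v
    by_contra! hv
    obtain ⟨M, hM⟩ := exists_nat_gt ((f (fun _ => ε) - b) / φ v)
    rw [div_lt_iff₀ hv] at hM
    have := hfb ((fun _ => ε) - (M : ℝ) • Pi.single v 1) (fun x => by
      by_cases hx : x = v <;> simp [hx])
    rw [map_sub, map_smul, smul_eq_mul] at this
    change b < f (fun _ => ε) - M * φ v at this
    linarith
  obtain ⟨i, hi⟩ := h (fun v => - φ v) fun v => neg_nonneg.2 (hφ v)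
  have h1 := hfa _ ⟨Pi.single i 1, single_mem_stdSimplex ℝ i, rfl⟩
  have h2 : f (T (Pi.single i 1)) = ∑ x ∈ Z i, φ x := by
    have hT : ∀ v, T (Pi.single i 1) v = if v ∈ Z i then 1 else 0 := fun v => by
      change (∑ j, if v ∈ Z j then (Pi.single i 1 : ι → ℝ) j else 0) = _
      rw [Finset.sum_eq_single i] <;> simp +contextual
    rw [hf]
    simp [hT, Finset.sum_ite_mem]
  rw [hf, ← Finset.mul_sum] at hconst
  simp only [Finset.sum_neg_distrib] at hi
  linarith

theorem lp.norm_one_eq_sum {V : Type*} [Fintype V] (f : lp (fun _ : V => ℝ) 1) :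
    ‖f‖ = ∑ x, |f x| := by
  rw [lp.norm_eq_tsum_rpow (by simp)]
  simp [tsum_fintype]

namespace SimpleGraph

variable {V : Type*} [Fintype V]

/-- `ξ x` is the law of the representative of the component of `x` after a random separator is cut
out. Adjacent vertices have the same representative unless the separator contains one of them, which
has probability at most `2 * ε`; each such event costs at most twice its probability in `ℓ¹`. -/
theorem IsWeightedHyperfinite.exists_propertyA_functions {G : SimpleGraph V} {ε : ℝ} {K : ℕ}
    (hG : G.IsWeightedHyperfinite ε K) :
    ∃ ξ : V → lp (fun _ : V => ℝ) 1, (∀ x, ‖ξ x‖ = 1) ∧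
      (∀ x y, ξ x y ≠ 0 → G.edist x y ≤ K) ∧ ∀ x y, G.Adj x y → ‖ξ x - ξ y‖ ≤ 4 * ε := by
  classical
  obtain ⟨π, hπ, hπε⟩ := exists_distribution_of_forall_weight
    (fun Z : {Z : Finset V // G.HasSmallPieces (Z : Set V)ᶜ K} => Z.1) (fun w hw => by
      obtain ⟨Z, hZ, hZK⟩ := hG w hw
      exact ⟨⟨Z, hZK⟩, hZ⟩)
  have hrep : ∀ Z : {Z : Finset V // G.HasSmallPieces (Z : Set V)ᶜ K}, ∃ ρ : V → V,
      (∀ x, G.edist x (ρ x) ≤ K) ∧ ∀ x y, x ∉ Z.1 → y ∉ Z.1 → G.Adj x y → ρ x = ρ y := by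
    rintro ⟨Z, c, hcK, hc⟩
    let G' : SimpleGraph V :=
      { Adj := fun x y => G.Adj x y ∧ x ∉ Z ∧ y ∉ Z
        symm := ⟨fun x y h => ⟨h.1.symm, h.2.2, h.2.1⟩⟩
        loopless := ⟨fun x h => h.1.ne rfl⟩ }
    obtain ⟨ρ, h1, h2⟩ := exists_representatives (G := G) (G' := G') (fun x y h => h.1)
      (c := fun x => if x ∈ Z then {x} else c x) (K := K) (fun x => by
        by_cases hx : x ∈ Z
        · simp [hx]
        · simpa [hx] using (hcK x (by simpa using hx)).1) (fun x => by
        by_cases hx : x ∈ Z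
        · simp [hx]
        · simpa [hx] using (hcK x (by simpa using hx)).2.trans K.le_succ) (fun x y h => by
        simpa [h.2.1, h.2.2] using hc x (by simpa using h.2.1) y (by simpa using h.2.2) h.1)
    exact ⟨ρ, h1, fun x y hx hy hxy => h2 x y ⟨hxy, hx, hy⟩⟩
  choose ρ hρK hρ using hrep
  let ξ : V → V → ℝ := fun x z => ∑ Z, if ρ Z x = z then π Z else 0
  have hξ0 : ∀ x z, 0 ≤ ξ x z := fun x z =>
    Finset.sum_nonneg fun Z _ => by split_ifs <;> simp [hπ.1 Z]
  refine ⟨fun x => ⟨ξ x, Memℓp.all _⟩, fun x => ?_, fun x y hxy => ?_, fun x y hxy => ?_⟩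
  · rw [lp.norm_one_eq_sum]
    change ∑ z, |ξ x z| = 1
    simp only [abs_of_nonneg (hξ0 _ _), ξ]
    rw [Finset.sum_comm]
    simpa using hπ.2
  · obtain ⟨Z, -, hZ⟩ := Finset.exists_ne_zero_of_sum_ne_zero hxy
    have : ρ Z x = y := by
      by_contra h
      simp [h] at hZ
    exact this ▸ hρK Z x
  · rw [lp.norm_one_eq_sum]
    change ∑ z, |ξ x z - ξ y z| ≤ 4 * ε
    have hZ : ∀ Z, ∑ z, |(if ρ Z x = z then π Z else 0) - (if ρ Z y = z then π Z else 0)| ≤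
        2 * (if x ∈ Z.1 then π Z else 0) + 2 * (if y ∈ Z.1 then π Z else 0) := by
      intro Z
      have hnn := hπ.1 Z
      by_cases hxy' : ρ Z x = ρ Z y
      · simp only [hxy', sub_self, abs_zero, Finset.sum_const_zero]
        split_ifs <;> linarith
      · have h2 : 2 * π Z ≤
            2 * (if x ∈ Z.1 then π Z else 0) + 2 * (if y ∈ Z.1 then π Z else 0) := by
          by_cases hx : x ∈ Z.1
          · simp only [hx, if_true]
            split_ifs <;> linarith
          · by_cases hy : y ∈ Z.1
            · simp [hx, hy]
            · exact absurd (hρ Z x y hx hy hxy) hxy'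
        refine le_trans ?_ h2
        calc _ ≤ ∑ z, ((if ρ Z x = z then π Z else 0) + (if ρ Z y = z then π Z else 0)) := by
              refine Finset.sum_le_sum fun z _ => ?_
              rw [abs_le]
              constructor <;> split_ifs <;> linarith
          _ = 2 * π Z := by simp [Finset.sum_add_distrib, two_mul]
    calc ∑ z, |ξ x z - ξ y z|
        ≤ ∑ z, ∑ Z, |(if ρ Z x = z then π Z else 0) - (if ρ Z y = z then π Z else 0)| := by
          refine Finset.sum_le_sum fun z _ => ?_
          rw [← Finset.sum_sub_distrib]
          exact Finset.abs_sum_le_sum_abs _ _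
      _ ≤ _ := by
          rw [Finset.sum_comm]
          refine (Finset.sum_le_sum fun Z _ => hZ Z).trans ?_
          rw [Finset.sum_add_distrib, ← Finset.mul_sum, ← Finset.mul_sum]
          linarith [hπε x, hπε y]

end SimpleGraph

/-! ### From amenability to property almost-A -/

theorem exists_diagonal {f : ℕ → ℕ → ℝ} (h0 : ∀ k n, 0 ≤ f k n)
    (hf : ∀ k, Tendsto (f k) atTop (𝓝 0)) :
    ∃ m : ℕ → ℕ, Tendsto m atTop atTop ∧ Tendsto (fun n => f (m n) n) atTop (𝓝 0) := by
  classical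
  let P : ℕ → ℕ → Prop := fun n k => f k n ≤ 1 / (k + 1)
  have hP : ∀ k, ∀ᶠ n in atTop, P n k := fun k =>
    (hf k).eventually_le_const (by positivity)
  -- The cap `n` makes the maximum exist. `Nat.findGreatest` returns `0` when nothing is found, so
  -- the final estimate also needs `P n 0`, which holds eventually.
  let m : ℕ → ℕ := fun n => Nat.findGreatest (P n) n
  have hm : Tendsto m atTop atTop := by
    refine tendsto_atTop.2 fun k => ?_
    filter_upwards [hP k, eventually_ge_atTop k] with n hn hkn
    exact Nat.le_findGreatest hkn hn
  refine ⟨m, hm, ?_⟩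
  refine squeeze_zero' (Eventually.of_forall fun n => h0 _ _) ?_
    (tendsto_one_div_add_atTop_nhds_zero_nat.comp hm)
  filter_upwards [hP 0] with n hn
  exact Nat.findGreatest_spec (P := P n) (Nat.zero_le n) hn

/-- The constants depend only on `S` and `ε`, through the Følner set and the words chosen for its
elements; this uniformity over graphs and weights is what the sequences need. -/
theorem IsAmenableGroup.exists_separator {Γ : Type*} [Group Γ] (hΓ : IsAmenableGroup Γ)
    {S : Finset Γ} (hS : Subgroup.closure (S : Set Γ) = ⊤) {ε : ℝ} (hε : 0 < ε) :
    ∃ r K : ℕ, ∀ {V : Type*} [Fintype V] (G : LabelledGraph S V) (X : Finset V),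
      (∀ x ∈ X, G.BallIso x (LabelledGraph.cayley S) 1 r) → ∀ w : V → ℝ, (∀ x, 0 ≤ w x) →
      ∃ Z ⊆ X, ∑ x ∈ Z, w x ≤ ε * ∑ x ∈ X, w x ∧ G.toSimpleGraph.HasSmallPieces (X \ Z) K := by
  choose u hu using LabelledGraph.exists_wordVal_eq hS
  obtain ⟨A, hA, hAε⟩ := hΓ.exists_right_folner S hε
  refine ⟨2 * A.sup (fun a => (u a).length) + 1, A.card, fun {V} _ G X hX w hw => ?_⟩
  refine G.toSimpleGraph.exists_separator_of_innerBoundary hw (fun H hH hpos => ?_) X subset_rfl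
  exact G.exists_small_innerBoundary hA hAε hu
    (fun a ha => Finset.le_sup (f := fun a => (u a).length) ha)
    (fun y hy => (hX y (hH hy)).exists_isChart) hw hpos

section Sequences

variable {Γ : Type*} [Group Γ] {S : Finset Γ} {V : ℕ → Type*} [∀ n, Finite (V n)]
  {G : ∀ n, LabelledGraph S (V n)}

theorem IsSoficApproximation.tendsto_not_ballIso (hG : IsSoficApproximation S G) (r : ℕ) :
    Tendsto (fun n =>
      ({x : V n | ¬ (G n).BallIso x (LabelledGraph.cayley S) 1 r}.ncard : ℝ) / Nat.card (V n))
      atTop (𝓝 0) := by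
  have h := (tendsto_const_nhds (x := (1 : ℝ))).sub (hG.tendsto_ball r)
  rw [sub_self] at h
  refine h.congr' ?_
  filter_upwards [hG.isGraphSequence.card_tendsto.eventually_ge_atTop 1] with n hn
  have h2 := Set.ncard_add_ncard_compl {x : V n | (G n).BallIso x (LabelledGraph.cayley S) 1 r}
  have h3 : (Nat.card (V n) : ℝ) ≠ 0 := by positivity
  rw [eq_div_iff h3, sub_mul, div_mul_cancel₀ _ h3, one_mul, ← h2]
  push_cast
  exact add_sub_cancel_left _ _

theorem IsAmenableGroup.hasPropertyAlmostA (hΓ : IsAmenableGroup Γ)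
    (hS : Subgroup.closure (S : Set Γ) = ⊤) (hG : IsSoficApproximation S G) :
    HasPropertyAlmostA fun n => (G n).toSimpleGraph := by
  classical
  have := fun n => Fintype.ofFinite (V n)
  let bad : ℕ → ∀ n, Set (V n) := fun r n =>
    {x | ¬ (G n).BallIso x (LabelledGraph.cayley S) 1 r}
  -- Summing over all radii up to `k` lets one delete the bad vertices for every such radius,
  -- without comparing ball isomorphisms of different radii.
  obtain ⟨m, hm, hm0⟩ := exists_diagonal
    (f := fun k n => ∑ i ∈ Finset.range (k + 1), ((bad i n).ncard : ℝ) / Nat.card (V n))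
    (fun k n => by positivity) (fun k => by
      simpa using tendsto_finsetSum (Finset.range (k + 1)) fun i _ => hG.tendsto_not_ballIso i)
  refine ⟨fun n => ⋃ i ∈ Finset.range (m n + 1), bad i n, ?_, fun ε hε => ?_⟩
  · refine squeeze_zero (fun n => by positivity) (fun n => ?_) hm0
    rw [← Finset.sum_div]
    gcongr
    exact_mod_cast Finset.set_ncard_biUnion_le _ _
  obtain ⟨r, K, hK⟩ := hΓ.exists_separator hS (show 0 < ε / 5 by positivity)
  obtain ⟨N, hN⟩ := eventually_atTop.1 (hm.eventually_ge_atTop r)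
  -- For `n ≥ N` the deletion already includes the vertices that are bad at radius `r`. The finitely
  -- many earlier graphs are absorbed in the bound on the pieces.
  have key : ∀ n, ((G n).toSimpleGraph.induce
      (⋃ i ∈ Finset.range (m n + 1), bad i n)ᶜ).IsWeightedHyperfinite (ε / 5)
        (max K ((Finset.range N).sup fun n => Nat.card (V n))) := by
    intro n
    rcases le_or_gt N n with hn | hn
    · refine SimpleGraph.IsWeightedHyperfinite.mono ?_ (le_max_left _ _)
      refine SimpleGraph.isWeightedHyperfinite_induce _ (hK (G n) _ fun x hx => ?_)
      by_contra hbad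
      rw [Set.mem_toFinset, Set.mem_compl_iff, Set.mem_iUnion₂] at hx
      exact hx ⟨r, Finset.mem_range.2 (Nat.lt_succ_of_le (hN n hn)), hbad⟩
    · refine SimpleGraph.isWeightedHyperfinite_of_card_le _ (by positivity) ?_
      refine le_trans ?_ ((Finset.le_sup (f := fun n => Nat.card (V n))
        (Finset.mem_range.2 hn)).trans (le_max_right _ _))
      rw [Nat.card_eq_fintype_card]
      exact Fintype.card_subtype_le _
  choose ξ hξ using fun n => (key n).exists_propertyA_functions
  exact ⟨_, ξ, fun n => ⟨(hξ n).1, (hξ n).2.1, fun x y hxy =>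
    ((hξ n).2.2 x y hxy).trans_lt (by linarith)⟩⟩

end Sequences

/-! ### From amenability to hyperfiniteness -/

namespace SimpleGraph

theorem ncard_supp_le_of_le {V : Type*} [Finite V] {G G' : SimpleGraph V} (h : G' ≤ G) {K : ℕ}
    (hK : ∀ C : G.ConnectedComponent, C.supp.ncard ≤ K) (C : G'.ConnectedComponent) :
    C.supp.ncard ≤ K := by
  induction C using ConnectedComponent.ind with
  | h x =>
    refine (Set.ncard_le_ncard (fun y hy => ?_)).trans (hK (G.connectedComponentMk x))
    rw [ConnectedComponent.mem_supp_iff, ConnectedComponent.eq] at hy ⊢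
    exact hy.mono h

theorem ncard_edges_meeting_le {V : Type*} [Finite V] (G : SimpleGraph V) {d : ℕ}
    (hd : ∀ x, (G.neighborSet x).ncard ≤ d) (B : Set V) :
    {e ∈ G.edgeSet | ∃ x ∈ B, x ∈ e}.ncard ≤ d * B.ncard := by
  classical
  have := Fintype.ofFinite V
  have hsub : {e ∈ G.edgeSet | ∃ x ∈ B, x ∈ e} ⊆
      (B.toFinset.biUnion fun x => G.incidenceFinset x : Finset (Sym2 V)) := by
    rintro e ⟨he, x, hx, hxe⟩
    simp only [Finset.coe_biUnion, Set.mem_iUnion]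
    exact ⟨x, by simpa using hx, by simpa using ⟨he, hxe⟩⟩
  refine (Set.ncard_le_ncard hsub).trans ?_
  rw [Set.ncard_coe_finset, Set.ncard_eq_toFinset_card', mul_comm]
  refine Finset.card_biUnion_le_card_mul _ _ _ fun x _ => ?_
  rw [card_incidenceFinset_eq_degree, ← card_neighborSet_eq_degree, ← Nat.card_eq_fintype_card]
  exact hd x

theorem ncard_supp_deleteEdges_edgeSet {V : Type*} [Finite V] (G : SimpleGraph V)
    (C : (G.deleteEdges G.edgeSet).ConnectedComponent) : C.supp.ncard ≤ 1 := by
  induction C using ConnectedComponent.ind with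
  | h x =>
    rw [Set.ncard_le_one]
    have : ∀ y, y ∈ ((G.deleteEdges G.edgeSet).connectedComponentMk x).supp → y = x := by
      intro y hy
      rw [ConnectedComponent.mem_supp_iff, ConnectedComponent.eq] at hy
      simpa using hy
    intro a ha b hb
    rw [this a ha, this b hb]

end SimpleGraph

/-- The definition requires the edge density to converge. Deleting more edges only refines the
components, so the deleted sets are padded to exactly `⌊η |V n|⌋` edges for large `n`; the
exceptional graphs lose all their edges. -/
theorem isHyperfinite_of_eventually {V : ℕ → Type*} [∀ n, Finite (V n)]
    {G : ∀ n, SimpleGraph (V n)} (hG : IsGraphSequence G)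
    (h : ∀ η : ℝ, 0 < η → ∃ K : ℕ, ∀ᶠ n in atTop, ∃ E ⊆ (G n).edgeSet,
      (E.ncard : ℝ) ≤ η * Nat.card (V n) ∧
      ∀ C : ((G n).deleteEdges E).ConnectedComponent, C.supp.ncard ≤ K) :
    IsHyperfinite G := by
  classical
  have := fun n => Fintype.ofFinite (V n)
  intro ε hε
  -- A connected graph has at least `|V| - 1 ≥ |V| / 2` edges once `|V| ≥ 2`, so `η ≤ 1 / 2` leaves
  -- room for padding.
  set η : ℝ := min (ε / 2) (1 / 2) with hη
  have hη0 : 0 < η := by positivity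
  obtain ⟨K, hK⟩ := h η hη0
  have key : ∀ n, ∃ E ⊆ (G n).edgeSet,
      (∀ C : ((G n).deleteEdges E).ConnectedComponent, C.supp.ncard ≤ max K 1) ∧
      ((2 ≤ Nat.card (V n) ∧ ∃ E ⊆ (G n).edgeSet, (E.ncard : ℝ) ≤ η * Nat.card (V n) ∧
        ∀ C : ((G n).deleteEdges E).ConnectedComponent, C.supp.ncard ≤ K) →
        E.ncard = ⌊η * Nat.card (V n)⌋₊) := by
    intro n
    by_cases hn : 2 ≤ Nat.card (V n) ∧ ∃ E ⊆ (G n).edgeSet, (E.ncard : ℝ) ≤ η * Nat.card (V n) ∧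
        ∀ C : ((G n).deleteEdges E).ConnectedComponent, C.supp.ncard ≤ K
    · obtain ⟨h2, E, hE, hEη, hEK⟩ := hn
      have h2' : (2 : ℝ) ≤ Nat.card (V n) := by exact_mod_cast h2
      have hedge : ⌊η * Nat.card (V n)⌋₊ ≤ (G n).edgeSet.ncard := by
        have h1 : (Nat.card (V n) : ℝ) ≤ (G n).edgeSet.ncard + 1 := by
          exact_mod_cast (hG.connected n).card_vert_le_card_edgeSet_add_one
        have h3 : η * Nat.card (V n) ≤ 1 / 2 * Nat.card (V n) := by
          gcongr
          exact min_le_right _ _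
        refine Nat.floor_le_of_le ?_
        linarith
      rw [← Nat.le_floor_iff (by positivity)] at hEη
      rw [Set.ncard_eq_toFinset_card'] at hedge hEη
      obtain ⟨E', hEE', hE', hcard⟩ :=
        Finset.exists_subsuperset_card_eq (Set.toFinset_subset_toFinset.2 hE) hEη hedge
      refine ⟨E', by simpa [← Finset.coe_subset] using hE', fun C => ?_,
        fun _ => by simpa using hcard⟩
      refine (SimpleGraph.ncard_supp_le_of_le ?_ hEK C).trans (le_max_left _ _)
      exact SimpleGraph.deleteEdges_anti (by simpa [← Finset.coe_subset] using hEE')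
    · exact ⟨(G n).edgeSet, subset_rfl,
        fun C => ((G n).ncard_supp_deleteEdges_edgeSet C).trans (le_max_right _ _),
        fun h => absurd h hn⟩
  choose E hE hEK hEη using key
  refine ⟨E, max K 1, η, by positivity, hE, ?_, ?_, hEK⟩
  · have hlim := (tendsto_nat_floor_mul_div_atTop hη0.le).comp
      (tendsto_natCast_atTop_atTop.comp hG.card_tendsto)
    refine hlim.congr' ?_
    filter_upwards [hK, hG.card_tendsto.eventually_ge_atTop 2] with n h1 h2
    simp [hEη n ⟨h2, h1⟩]
  · exact (min_le_left _ _).trans_lt (by linarith)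

theorem IsAmenableGroup.isHyperfinite {Γ : Type*} [Group Γ] {S : Finset Γ} {V : ℕ → Type*}
    [∀ n, Finite (V n)] {G : ∀ n, LabelledGraph S (V n)} (hΓ : IsAmenableGroup Γ)
    (hS : Subgroup.closure (S : Set Γ) = ⊤) (hG : IsSoficApproximation S G) :
    IsHyperfinite fun n => (G n).toSimpleGraph := by
  classical
  have := fun n => Fintype.ofFinite (V n)
  refine isHyperfinite_of_eventually hG.isGraphSequence fun η hη => ?_
  obtain ⟨d, hd⟩ := hG.isGraphSequence.bounded_degree
  -- Bad vertices and separator contribute `δ |V|` vertices each, and every vertex meets at most `d`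
  -- edges.
  set δ : ℝ := η / (2 * (d + 1)) with hδ
  have hδ0 : 0 < δ := by positivity
  obtain ⟨r, K, hK⟩ := hΓ.exists_separator hS hδ0
  refine ⟨max K 1, ?_⟩
  filter_upwards [(hG.tendsto_not_ballIso r).eventually_le_const hδ0,
    hG.isGraphSequence.card_tendsto.eventually_ge_atTop 1] with n hn hn1
  set X : Finset (V n) :=
    Finset.univ.filter fun x => (G n).BallIso x (LabelledGraph.cayley S) 1 r with hX
  obtain ⟨Z, hZX, hZ, c, hcK, hc⟩ := hK (G n) X (by simp [hX]) (fun _ => 1) (by simp)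
  have hcard : (0 : ℝ) < Nat.card (V n) := by exact_mod_cast hn1
  rw [div_le_iff₀ hcard] at hn
  set B : Set (V n) := (X \ Z : Set (V n))ᶜ with hB
  have hBcard : (B.ncard : ℝ) ≤ 2 * δ * Nat.card (V n) := by
    have hsub : B ⊆ {x : V n | ¬ (G n).BallIso x (LabelledGraph.cayley S) 1 r} ∪ Z := by
      intro x hx
      by_contra h
      simp only [Set.mem_union, not_or] at h
      exact hx ⟨by simpa [hX] using h.1, h.2⟩
    have h1 : B.ncard ≤ {x : V n | ¬ (G n).BallIso x (LabelledGraph.cayley S) 1 r}.ncard +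
        Z.card := by
      refine (Set.ncard_le_ncard hsub).trans ((Set.ncard_union_le _ _).trans ?_)
      rw [Set.ncard_coe_finset]
    have h2 : (Z.card : ℝ) ≤ δ * Nat.card (V n) := by
      simp only [Finset.sum_const, nsmul_eq_mul, mul_one] at hZ
      refine hZ.trans (mul_le_mul_of_nonneg_left ?_ hδ0.le)
      rw [Nat.card_eq_fintype_card]
      exact_mod_cast Finset.card_le_univ X
    have h1' : (B.ncard : ℝ) ≤
        ({x : V n | ¬ (G n).BallIso x (LabelledGraph.cayley S) 1 r}.ncard : ℝ) + Z.card := by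
      exact_mod_cast h1
    linarith
  refine ⟨{e ∈ (G n).toSimpleGraph.edgeSet | ∃ x ∈ B, x ∈ e}, fun e he => he.1, ?_, fun C => ?_⟩
  · calc ({e ∈ (G n).toSimpleGraph.edgeSet | ∃ x ∈ B, x ∈ e}.ncard : ℝ)
        ≤ d * B.ncard := by
          exact_mod_cast (G n).toSimpleGraph.ncard_edges_meeting_le (hd n) B
      _ ≤ (d + 1) * (2 * δ * Nat.card (V n)) := by
          gcongr
          linarith
      _ = η * Nat.card (V n) := by
          rw [hδ]
          field_simp
  · induction C using SimpleGraph.ConnectedComponent.ind with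
    | h x =>
    let c' : V n → Finset (V n) := fun x => if x ∈ B then {x} else c x
    have hnB : ∀ {x}, x ∉ B → x ∈ (X \ Z : Set (V n)) := fun h => by simpa [hB] using h
    have hmem : ∀ x, x ∈ c' x := fun x => by
      by_cases h : x ∈ B
      · simp [c', h]
      · simpa [c', h] using (hcK x (hnB h)).1
    have hcard : ∀ x, (c' x).card ≤ max K 1 := fun x => by
      by_cases h : x ∈ B
      · simp [c', h]
      · simpa [c', h] using .inl (hcK x (hnB h)).2
    have hadj : ∀ x y, ((G n).toSimpleGraph.deleteEdges
        {e ∈ (G n).toSimpleGraph.edgeSet | ∃ x ∈ B, x ∈ e}).Adj x y → c' x = c' y := by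
      intro x y hxy
      rw [SimpleGraph.deleteEdges_adj] at hxy
      have h : ∀ z ∈ s(x, y), z ∉ B := fun z hz hzB => hxy.2 ⟨hxy.1, z, hzB, hz⟩
      have hx := h x (by simp)
      have hy := h y (by simp)
      simpa [c', hx, hy] using hc x (hnB hx) y (hnB hy) hxy.1
    refine le_trans (Set.ncard_le_ncard (t := c' x) fun y hy => ?_)
      ((Set.ncard_coe_finset _).trans_le (hcard x))
    rw [SimpleGraph.ConnectedComponent.mem_supp_iff, SimpleGraph.ConnectedComponent.eq] at hy
    have := (SimpleGraph.eq_and_edist_le_of_reachable hmem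
      (fun x => (hcard x).trans (Nat.le_succ _)) hadj hy).1
    exact this ▸ hmem y

/-! ### Level sets and Følner sets -/

open scoped Classical in
/-- A level set of a function with small variation has small boundary. -/
theorem exists_level_set {V : Type*} [Fintype V] (P : Finset (V × V)) {ε : ℝ} :
    ∀ (k : ℕ) (f : V → ℝ), (Finset.univ.filter fun x => f x ≠ 0).card = k → (∀ x, 0 ≤ f x) →
      0 < ∑ x, f x → ∑ p ∈ P, |f p.1 - f p.2| ≤ ε * ∑ x, f x →
      ∃ A : Finset V, A.Nonempty ∧ (∀ x ∈ A, f x ≠ 0) ∧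
        ((P.filter fun p => p.1 ∈ A ∧ p.2 ∉ A).card : ℝ) ≤ ε * A.card := by
  intro k
  induction k using Nat.strong_induction_on with
  | _ k ih =>
  intro f hk h0 hpos hf
  set F : Finset V := Finset.univ.filter fun x => f x ≠ 0 with hF
  have hmemF : ∀ {x}, x ∈ F ↔ f x ≠ 0 := by simp [hF]
  have hFne : F.Nonempty := by
    obtain ⟨x, -, hx⟩ := Finset.exists_ne_zero_of_sum_ne_zero hpos.ne'
    exact ⟨x, hmemF.2 hx⟩
  by_cases hFε : ((P.filter fun p => p.1 ∈ F ∧ p.2 ∉ F).card : ℝ) ≤ ε * F.card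
  · exact ⟨F, hFne, fun x hx => hmemF.1 hx, hFε⟩
  rw [not_le] at hFε
  obtain ⟨x₀, hx₀, hmin⟩ := F.exists_min_image f hFne
  have hm : 0 < f x₀ := (h0 x₀).lt_of_ne (hmemF.1 hx₀).symm
  -- A discrete layer-cake argument: peel off the lowest layer. If its support `F` has too large a
  -- boundary, the variation drops by more than `ε` times the drop of the sum, so the hypothesis
  -- survives on a smaller support.
  set f' : V → ℝ := fun x => if x ∈ F then f x - f x₀ else 0 with hf'
  have h0' : ∀ x, 0 ≤ f' x := fun x => by
    by_cases hx : x ∈ F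
    · simpa [hf', hx] using hmin x hx
    · simp [hf', hx]
  have hsum : ∑ x, f x = ∑ x, f' x + f x₀ * F.card := by
    have : ∀ x, f x = f' x + if x ∈ F then f x₀ else 0 := fun x => by
      by_cases hx : x ∈ F
      · simp [hf', hx]
      · simp only [hf', hx, if_false, add_zero]
        by_contra h
        exact hx (hmemF.2 h)
    rw [Finset.sum_congr rfl fun x _ => this x, Finset.sum_add_distrib]
    simp [Finset.sum_ite_mem, mul_comm]
  have hvar : ∑ p ∈ P, |f' p.1 - f' p.2| + f x₀ * (P.filter fun p => p.1 ∈ F ∧ p.2 ∉ F).card ≤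
      ∑ p ∈ P, |f p.1 - f p.2| := by
    have h1 : f x₀ * (P.filter fun p => p.1 ∈ F ∧ p.2 ∉ F).card =
        ∑ p ∈ P, if p.1 ∈ F ∧ p.2 ∉ F then f x₀ else 0 := by
      rw [← Finset.sum_filter]
      simp [mul_comm]
    rw [h1, ← Finset.sum_add_distrib]
    refine Finset.sum_le_sum fun p _ => ?_
    have hz : ∀ x, x ∉ F → f x = 0 := fun x hx => by simpa [hmemF] using hx
    by_cases h1 : p.1 ∈ F <;> by_cases h2 : p.2 ∈ F
    · simp [hf', h1, h2]
    · have := hmin _ h1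
      simp only [hf', h1, h2, hz _ h2, if_true, if_false, sub_zero, not_false_eq_true, and_self]
      rw [abs_of_nonneg (by linarith), abs_of_nonneg (h0 _)]
      linarith
    · have := hmin _ h2
      simp only [hf', h1, h2, hz _ h1, if_true, if_false, zero_sub, abs_neg, false_and, add_zero]
      rw [abs_of_nonneg (by linarith), abs_of_nonneg (h0 _)]
      linarith
    · simp [hf', h1, h2]
  have hlt : ∑ p ∈ P, |f' p.1 - f' p.2| < ε * ∑ x, f' x := by
    have := mul_lt_mul_of_pos_left hFε hm
    rw [hsum] at hf
    linarith
  have hpos' : 0 < ∑ x, f' x := by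
    refine (Finset.sum_nonneg fun x _ => h0' x).lt_of_ne fun h => ?_
    rw [← h, mul_zero] at hlt
    exact absurd hlt (not_lt.2 (Finset.sum_nonneg fun _ _ => abs_nonneg _))
  have hsub : (Finset.univ.filter fun x => f' x ≠ 0) ⊂ F := by
    refine Finset.ssubset_iff_subset_ne.2 ⟨fun x hx => ?_, fun h => ?_⟩
    · by_contra hxF
      simp [hf', hxF] at hx
    · have : x₀ ∈ Finset.univ.filter fun x => f' x ≠ 0 := h ▸ hx₀
      simp [hf'] at this
  obtain ⟨A, hA, hAf, hAε⟩ := ih _ (hk ▸ Finset.card_lt_card hsub) f' rfl h0' hpos' hlt.le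
  exact ⟨A, hA, fun x hx => hmemF.1 (hsub.1 (by simpa using hAf x hx)), hAε⟩

section Folner

variable {Γ : Type*} [Group Γ] {S : Finset Γ}

-- The displacement of `F` is subadditive in the group element and invariant under inversion, so the
-- generators control it with a constant independent of `F`.
open scoped Classical Pointwise in
theorem card_symmDiff_smul_le_of_closure (hS : Subgroup.closure (S : Set Γ) = ⊤) (g : Γ) :
    ∃ c : ℝ, ∀ (F : Finset Γ) (δ : ℝ), (∀ s ∈ S, ((symmDiff (s • F) F).card : ℝ) ≤ δ) →
      ((symmDiff (g • F) F).card : ℝ) ≤ c * δ := by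
  have hg : g ∈ Subgroup.closure (S : Set Γ) := hS ▸ Subgroup.mem_top g
  induction hg using Subgroup.closure_induction with
  | mem s hs => exact ⟨1, fun F δ h => by simpa using h s hs⟩
  | one => exact ⟨0, fun F δ h => by simp⟩
  | mul g h _ _ ihg ihh =>
    obtain ⟨c, hc⟩ := ihg
    obtain ⟨c', hc'⟩ := ihh
    refine ⟨c' + c, fun F δ hδ => ?_⟩
    have h1 : (symmDiff ((g * h) • F) F).card ≤
        (symmDiff (h • F) F).card + (symmDiff (g • F) F).card := by
      refine (Finset.card_le_card (symmDiff_triangle _ (g • F) _)).trans ?_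
      refine (Finset.card_union_le _ _).trans ?_
      rw [mul_smul, ← Finset.smul_finset_symmDiff, Finset.card_smul_finset]
    have h2 : ((symmDiff ((g * h) • F) F).card : ℝ) ≤
        (symmDiff (h • F) F).card + (symmDiff (g • F) F).card := by exact_mod_cast h1
    linarith [hc F δ hδ, hc' F δ hδ]
  | inv g _ ih =>
    obtain ⟨c, hc⟩ := ih
    refine ⟨c, fun F δ hδ => ?_⟩
    have : symmDiff (g⁻¹ • F) F = g⁻¹ • symmDiff (g • F) F := by
      rw [Finset.smul_finset_symmDiff, inv_smul_smul, symmDiff_comm]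
    rw [this, Finset.card_smul_finset]
    exact hc F δ hδ

-- Inversion exchanges right and left translation. Since `s • F` and `F` have equal size, the two
-- halves of their symmetric difference do too, whence the factor `2`.
open scoped Classical Pointwise in
theorem isAmenableGroup_of_right_folner (hS : Subgroup.closure (S : Set Γ) = ⊤)
    (h : ∀ ε : ℝ, 0 < ε → ∃ F : Finset Γ, F.Nonempty ∧
      ∀ s ∈ S, ((F.filter fun g => g * s ∉ F).card : ℝ) ≤ ε * F.card) :
    IsAmenableGroup Γ := by
  intro T ε hε
  choose c hc using card_symmDiff_smul_le_of_closure hS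
  set C : ℝ := ∑ g ∈ T, |c g| with hC
  have hC0 : 0 ≤ C := Finset.sum_nonneg fun _ _ => abs_nonneg _
  obtain ⟨F, hF, hFS⟩ := h (ε / (2 * (C + 1))) (by positivity)
  have hcard : (F.image (·⁻¹)).card = F.card := Finset.card_image_of_injective _ inv_injective
  refine ⟨F.image (·⁻¹), hF.image _, fun g hg => ?_⟩
  rw [hcard]
  have hFS' : ∀ s ∈ S, ((symmDiff (s • F.image (·⁻¹)) (F.image (·⁻¹))).card : ℝ) ≤
      ε / (C + 1) * F.card := by
    intro s hs
    have h1 : (F.image (·⁻¹) \ s • F.image (·⁻¹)).card ≤ (F.filter fun g => g * s ∉ F).card := by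
      refine Finset.card_le_card_of_injOn (·⁻¹) (fun x hx => ?_) inv_injective.injOn
      simp only [Finset.coe_sdiff, Set.mem_sdiff, Finset.mem_coe, Finset.mem_image] at hx
      obtain ⟨⟨g, hg, rfl⟩, hx⟩ := hx
      simp only [inv_inv, Finset.mem_coe, Finset.mem_filter]
      refine ⟨hg, fun hgs => hx (Finset.mem_smul_finset.2 ⟨(g * s)⁻¹, ?_, by simp⟩)⟩
      exact Finset.mem_image_of_mem _ hgs
    have h2 : (s • F.image (·⁻¹) \ F.image (·⁻¹)).card =
        (F.image (·⁻¹) \ s • F.image (·⁻¹)).card :=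
      Finset.card_sdiff_comm (Finset.card_smul_finset _ _)
    have h3 : (symmDiff (s • F.image (·⁻¹)) (F.image (·⁻¹))).card ≤
        2 * (F.filter fun g => g * s ∉ F).card := by
      refine (Finset.card_union_le _ _).trans ?_
      omega
    calc _ ≤ 2 * ((F.filter fun g => g * s ∉ F).card : ℝ) := by exact_mod_cast h3
      _ ≤ 2 * (ε / (2 * (C + 1)) * F.card) := by gcongr; exact hFS s hs
      _ = _ := by field_simp
  calc _ ≤ c g * (ε / (C + 1) * F.card) := hc g _ _ hFS'
    _ ≤ C * (ε / (C + 1) * F.card) := by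
        gcongr
        exact (le_abs_self _).trans (Finset.single_le_sum (f := fun g => |c g|)
          (fun _ _ => abs_nonneg _) hg)
    _ = C / (C + 1) * (ε * F.card) := by ring
    _ ≤ 1 * (ε * F.card) := by
        gcongr
        rw [div_le_one (by positivity)]
        linarith
    _ = _ := one_mul _

-- The extra unit of radius makes each `f a * s` the image of a vertex `b`; if it leaves the image
-- of `A`, then `(a, b)` is an edge leaving `A`.
open scoped Classical in
theorem LabelledGraph.IsChart.exists_right_folner {V : Type*} [Fintype V] {G : LabelledGraph S V}
    {x : V} {r : ℕ} {f : V → Γ} (hf : G.IsChart x (r + 1) f) {A : Finset V}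
    (hA : ∀ a ∈ A, a ∈ G.ball x r) :
    (A.image f).card = A.card ∧ ∀ s ∈ S, ((A.image f).filter fun g => g * s ∉ A.image f).card ≤
      ((Finset.univ.filter fun p : V × V => G.toSimpleGraph.Adj p.1 p.2).filter
        fun p => p.1 ∈ A ∧ p.2 ∉ A).card := by
  have hA' : ∀ a ∈ A, a ∈ G.ball x (r + 1) := fun a ha => G.ball_mono _ r.le_succ (hA a ha)
  refine ⟨Finset.card_image_of_injOn fun a ha b hb => hf.injOn (hA' a ha) (hA' b hb),
    fun s hs => ?_⟩
  refine (Finset.card_le_card (t := (((Finset.univ.filter fun p : V × V =>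
    G.toSimpleGraph.Adj p.1 p.2).filter fun p => p.1 ∈ A ∧ p.2 ∉ A).image fun p => f p.1))
    fun g hg => ?_).trans Finset.card_image_le
  obtain ⟨hg, hgs⟩ := Finset.mem_filter.1 hg
  obtain ⟨a, ha, rfl⟩ := Finset.mem_image.1 hg
  have hmem : f a * s ∈ (cayley S).ball 1 (r + 1) :=
    mem_ball_trans (hf.mem_ball r.le_succ (hA a ha))
      (cayley_step (p := (⟨s, hs⟩, true)).2 rfl).mem_ball_one
  obtain ⟨b, hb, hfb⟩ := hf.surjOn le_rfl hmem
  have hbA : b ∉ A := fun h => hgs (hfb ▸ Finset.mem_image_of_mem _ h)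
  refine Finset.mem_image.2 ⟨(a, b), ?_, rfl⟩
  simp only [Finset.mem_filter, Finset.mem_univ, true_and]
  refine ⟨G.toSimpleGraph_adj.2 ⟨fun h => hbA (h ▸ ha), (⟨s, hs⟩, true), ?_⟩, ha, hbA⟩
  exact (hf.step_iff (hA' a ha) hb _).2 hfb.symm

end Folner

section Counting

variable {V : Type*} [Fintype V]

open scoped Classical in
theorem card_filter_sym2_mk_mem_le (E : Set (Sym2 V)) :
    (Finset.univ.filter fun p : V × V => s(p.1, p.2) ∈ E).card ≤ 2 * E.ncard := by
  rw [Set.ncard_eq_toFinset_card']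
  refine Finset.card_le_mul_card_image_of_maps_to (f := fun p : V × V => s(p.1, p.2))
    (fun p hp => by simpa using hp) 2 fun e _ => ?_
  induction e using Sym2.inductionOn with
  | hf a b =>
  refine (Finset.card_le_card (t := {(a, b), (b, a)}) fun p hp => ?_).trans Finset.card_le_two
  have := (Finset.mem_filter.1 hp).2
  rw [Sym2.eq_iff] at this
  simpa [Prod.ext_iff] using this

open scoped Classical in
theorem card_filter_adj_le (G : SimpleGraph V) {d : ℕ} (hd : ∀ x, (G.neighborSet x).ncard ≤ d) :
    (Finset.univ.filter fun p : V × V => G.Adj p.1 p.2).card ≤ d * Fintype.card V := by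
  refine Finset.card_le_mul_card_image_of_maps_to (f := Prod.fst) (t := Finset.univ)
    (fun p _ => Finset.mem_univ _) d fun x _ => le_trans ?_ (hd x)
  rw [Set.ncard_eq_toFinset_card']
  refine Finset.card_le_card_of_injOn Prod.snd (fun p hp => ?_) fun p hp q hq h => ?_
  · obtain ⟨h, rfl⟩ : G.Adj p.1 p.2 ∧ p.1 = x := by simpa using hp
    simpa using h
  · obtain ⟨-, rfl⟩ : G.Adj p.1 p.2 ∧ p.1 = x := by simpa using hp
    obtain ⟨-, hq⟩ : G.Adj q.1 q.2 ∧ q.1 = p.1 := by simpa using hq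
    exact Prod.ext hq.symm h

end Counting

/-! ### Slow kernels and Følner sets -/

/-- A kernel with uniformly bounded propagation that varies little along most edges. -/
structure IsSlowKernel {V : Type*} [Fintype V] (G : SimpleGraph V) (ε : ℝ) (R : ℕ)
    (ξ : V → V → ℝ) (B : Set V) (E : Set (Sym2 V)) : Prop where
  nonneg : ∀ x z, 0 ≤ ξ x z
  edist_le : ∀ x z, ξ x z ≠ 0 → G.edist x z ≤ R
  sum_le : ∀ x, ∑ z, ξ x z ≤ 1
  sum_eq : ∀ x ∉ B, ∑ z, ξ x z = 1
  ncard_vertices_le : (B.ncard : ℝ) ≤ ε * Fintype.card V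
  ncard_edges_le : (E.ncard : ℝ) ≤ ε * Fintype.card V
  variation_le : ∀ x y, G.Adj x y → s(x, y) ∉ E → ∑ z, |ξ x z - ξ y z| ≤ ε

-- At most `d |V|` ordered adjacent pairs contribute `ε` each. The at most `2 ε |V|` ordered pairs
-- from exceptional edges contribute up to `2` more each, hence the `4`.
open scoped Classical in
theorem IsSlowKernel.variation_sum_le {V : Type*} [Fintype V] {G : SimpleGraph V} {ε : ℝ}
    (hε : 0 ≤ ε) {R d : ℕ} {ξ : V → V → ℝ} {B : Set V} {E : Set (Sym2 V)}
    (h : IsSlowKernel G ε R ξ B E) (hd : ∀ x, (G.neighborSet x).ncard ≤ d) :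
    ∑ p ∈ Finset.univ.filter (fun p : V × V => G.Adj p.1 p.2), ∑ z, |ξ p.1 z - ξ p.2 z| ≤
      ε * (d + 4) * Fintype.card V := by
  have htwo : ∀ x y, ∑ z, |ξ x z - ξ y z| ≤ 2 := fun x y => by
    calc _ ≤ ∑ z, (ξ x z + ξ y z) := by
          refine Finset.sum_le_sum fun z _ => ?_
          rw [abs_le]
          constructor <;> linarith [h.nonneg x z, h.nonneg y z]
      _ ≤ 2 := by
          rw [Finset.sum_add_distrib]
          linarith [h.sum_le x, h.sum_le y]
  set P := Finset.univ.filter (fun p : V × V => G.Adj p.1 p.2) with hP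
  have hPcard : (P.card : ℝ) ≤ d * Fintype.card V := by
    exact_mod_cast card_filter_adj_le G hd
  have hEcard : ((P.filter fun p => s(p.1, p.2) ∈ E).card : ℝ) ≤ 2 * E.ncard := by
    have := (Finset.card_le_card (Finset.filter_subset_filter _ (Finset.subset_univ P))).trans
      (card_filter_sym2_mk_mem_le E)
    exact_mod_cast this
  calc _ ≤ ∑ p ∈ P, (ε + if s(p.1, p.2) ∈ E then 2 else 0) := by
        refine Finset.sum_le_sum fun p hp => ?_
        split_ifs with hpE
        · linarith [htwo p.1 p.2]
        · rw [add_zero]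
          exact h.variation_le _ _ (by simpa [hP] using hp) hpE
    _ = P.card * ε + (P.filter fun p => s(p.1, p.2) ∈ E).card * 2 := by
        rw [Finset.sum_add_distrib, ← Finset.sum_filter]
        simp
    _ ≤ d * Fintype.card V * ε + 2 * (ε * Fintype.card V) * 2 := by
        gcongr
        exact hEcard.trans (by linarith [h.ncard_edges_le])
    _ = _ := by ring

-- Pigeonhole over columns: the total variation is at most `δ / 2 * |V|`, while the columns in `Z`
-- carry mass at least `|V| / 2`, so one of them has variation at most `δ` times its mass.
open scoped Classical in
theorem IsSlowKernel.exists_right_folner {Γ : Type*} [Group Γ] {S : Finset Γ} {V : Type*}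
    [Fintype V] {G : LabelledGraph S V} {ε δ : ℝ} (hε : 0 ≤ ε) {R d : ℕ} {ξ : V → V → ℝ}
    {B : Set V} {E : Set (Sym2 V)} (h : IsSlowKernel G.toSimpleGraph ε R ξ B E)
    (hd : ∀ x, (G.toSimpleGraph.neighborSet x).ncard ≤ d) (hε4 : ε ≤ 1 / 4) (hδ : 0 ≤ δ)
    (hεδ : ε * (d + 4) ≤ δ / 2) (hV : 0 < Fintype.card V)
    (hbad : ({x | ¬ G.BallIso x (LabelledGraph.cayley S) 1 (R + R + 1)}.ncard : ℝ) ≤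
      1 / 4 * Fintype.card V) :
    ∃ F : Finset Γ, F.Nonempty ∧
      ∀ s ∈ S, ((F.filter fun g => g * s ∉ F).card : ℝ) ≤ δ * F.card := by
  have hV' : (0 : ℝ) < Fintype.card V := by exact_mod_cast hV
  set X : Finset V := Finset.univ.filter fun x =>
    G.BallIso x (LabelledGraph.cayley S) 1 (R + R + 1) ∧ x ∉ B with hX
  have hXcard : (Fintype.card V : ℝ) / 2 ≤ X.card := by
    have h1 : Fintype.card V ≤ X.card +
        ({x | ¬ G.BallIso x (LabelledGraph.cayley S) 1 (R + R + 1)}.ncard + B.ncard) := by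
      rw [← Nat.card_eq_fintype_card, ← Set.ncard_add_ncard_compl (X : Set V), Set.ncard_coe_finset]
      gcongr
      refine (Set.ncard_le_ncard fun x hx => ?_).trans (Set.ncard_union_le _ _)
      by_contra hx'
      simp only [Set.mem_union, not_or] at hx'
      exact hx (by simpa [hX] using hx')
    have h2 : (Fintype.card V : ℝ) ≤ X.card +
        ({x | ¬ G.BallIso x (LabelledGraph.cayley S) 1 (R + R + 1)}.ncard + B.ncard) := by
      exact_mod_cast h1
    have h3 : ε * Fintype.card V ≤ 1 / 4 * Fintype.card V := by gcongr
    linarith [h.ncard_vertices_le]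
  -- Only columns met by a good vertex `x₀` are used: their support lies within `R` of `z`, hence
  -- within `R + R` of `x₀`, where a chart is available.
  set Z : Finset V := Finset.univ.filter fun z => ∃ x ∈ X, ξ x z ≠ 0 with hZ
  set P := Finset.univ.filter (fun p : V × V => G.toSimpleGraph.Adj p.1 p.2) with hP
  have hmass : (X.card : ℝ) ≤ ∑ z ∈ Z, ∑ x, ξ x z := by
    calc (X.card : ℝ) = ∑ x ∈ X, ∑ z, ξ x z := by
          rw [Finset.sum_congr rfl fun x hx => h.sum_eq x (Finset.mem_filter.1 hx).2.2]
          simp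
      _ = ∑ x ∈ X, ∑ z ∈ Z, ξ x z := by
          refine Finset.sum_congr rfl fun x hx => ?_
          refine (Finset.sum_subset (Finset.subset_univ Z) fun z _ hz => ?_).symm
          by_contra hne
          exact hz (Finset.mem_filter.2 ⟨Finset.mem_univ _, x, hx, hne⟩)
      _ ≤ ∑ x, ∑ z ∈ Z, ξ x z :=
          Finset.sum_le_sum_of_subset_of_nonneg (Finset.subset_univ X)
            fun x _ _ => Finset.sum_nonneg fun z _ => h.nonneg x z
      _ = _ := Finset.sum_comm
  obtain ⟨z, hzZ, hz⟩ : ∃ z ∈ Z, ∑ p ∈ P, |ξ p.1 z - ξ p.2 z| ≤ δ * ∑ x, ξ x z := by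
    by_contra! hcon
    have hZne : Z.Nonempty := by
      by_contra hZe
      rw [Finset.not_nonempty_iff_eq_empty] at hZe
      rw [hZe, Finset.sum_empty] at hmass
      linarith
    have h1 := Finset.sum_lt_sum_of_nonempty hZne hcon
    rw [← Finset.mul_sum] at h1
    have h2 : ∑ z ∈ Z, ∑ p ∈ P, |ξ p.1 z - ξ p.2 z| ≤ ε * (d + 4) * Fintype.card V := by
      refine le_trans ?_ (h.variation_sum_le hε hd)
      rw [Finset.sum_comm]
      exact Finset.sum_le_sum fun p _ => Finset.sum_le_sum_of_subset_of_nonneg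
        (Finset.subset_univ Z) fun _ _ _ => abs_nonneg _
    have h3 : ε * (d + 4) * Fintype.card V ≤ δ / 2 * Fintype.card V := by gcongr
    have h4 := mul_le_mul_of_nonneg_left (hXcard.trans hmass) hδ
    linarith
  obtain ⟨x₀, hx₀, hx₀z⟩ := (Finset.mem_filter.1 hzZ).2
  have hpos : 0 < ∑ x, ξ x z :=
    ((h.nonneg x₀ z).lt_of_ne hx₀z.symm).trans_le
      (Finset.single_le_sum (f := fun x => ξ x z) (fun x _ => h.nonneg x z) (Finset.mem_univ x₀))
  obtain ⟨A, hA, hAξ, hAδ⟩ :=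
    exists_level_set P _ (fun x => ξ x z) rfl (fun x => h.nonneg x z) hpos hz
  obtain ⟨f, hf⟩ := (Finset.mem_filter.1 hx₀).2.1.exists_isChart
  obtain ⟨hcard, hF⟩ := hf.exists_right_folner (A := A) fun a ha =>
    LabelledGraph.mem_ball_trans (h.edist_le x₀ z hx₀z)
      (LabelledGraph.mem_ball_comm.1 (h.edist_le a z (hAξ a ha)))
  refine ⟨A.image f, hA.image f, fun s hs => le_trans ?_ (hcard.symm ▸ hAδ)⟩
  exact_mod_cast hF s hs

/-- Extend by zero across the deleted vertices and declare these, and all edges meeting them,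
exceptional; the factor `d + 1` in `hW` bounds both numbers. Absolute values restore nonnegativity
without increasing variation, and distances only shrink from the induced subgraph to `G`. -/
theorem exists_isSlowKernel_of_induce {V : Type*} [Fintype V] {G : SimpleGraph V} {W : Set V}
    {ε : ℝ} {R d : ℕ} (hd : ∀ x, (G.neighborSet x).ncard ≤ d)
    (hW : ((d : ℝ) + 1) * W.ncard ≤ ε * Fintype.card V)
    {ξ : (Wᶜ : Set V) → lp (fun _ : (Wᶜ : Set V) => ℝ) 1} (hnorm : ∀ x, ‖ξ x‖ = 1)
    (hsupp : ∀ x y, ξ x y ≠ 0 → (G.induce Wᶜ).edist x y ≤ R)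
    (hvar : ∀ x y, (G.induce Wᶜ).Adj x y → ‖ξ x - ξ y‖ < ε) :
    ∃ ξ B E, IsSlowKernel G ε R ξ B E := by
  classical
  have hW0 : (0 : ℝ) ≤ W.ncard := by positivity
  have hd0 : (0 : ℝ) ≤ d := by positivity
  let ζ : V → V → ℝ := fun x z => if h : x ∈ Wᶜ ∧ z ∈ Wᶜ then |ξ ⟨x, h.1⟩ ⟨z, h.2⟩| else 0
  have hζ : ∀ x z : (Wᶜ : Set V), ζ x z = |ξ x z| := fun x z => dif_pos ⟨x.2, z.2⟩
  have hsum : ∀ F : V → ℝ, (∀ z ∈ W, F z = 0) → ∑ z, F z = ∑ z : (Wᶜ : Set V), F z :=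
    fun F hF => by
      rw [← Finset.sum_subtype (Wᶜ : Set V).toFinset (by simp) F]
      refine (Finset.sum_subset (Finset.subset_univ _) fun z _ hz => hF z ?_).symm
      simpa using hz
  have hζW : ∀ x, ∀ z ∈ W, ζ x z = 0 := fun x z hz => dif_neg fun h => h.2 hz
  have hζ1 : ∀ x ∉ W, ∑ z, ζ x z = 1 := fun x hx => by
    rw [hsum _ (hζW x), ← hnorm ⟨x, hx⟩, lp.norm_one_eq_sum]
    exact Finset.sum_congr rfl fun z _ => hζ ⟨x, hx⟩ z
  refine ⟨ζ, W, {e ∈ G.edgeSet | ∃ x ∈ W, x ∈ e}, fun x z => ?_, fun x z hxz => ?_, fun x => ?_,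
    hζ1, by nlinarith, ?_, fun x y hxy hE => ?_⟩
  · by_cases h : x ∈ Wᶜ ∧ z ∈ Wᶜ
    · simp only [ζ, dif_pos h, abs_nonneg]
    · simp only [ζ, dif_neg h, le_refl]
  · by_cases h : x ∈ Wᶜ ∧ z ∈ Wᶜ
    · simp only [ζ, dif_pos h, ne_eq, abs_eq_zero] at hxz
      have hedist := hsupp ⟨x, h.1⟩ ⟨z, h.2⟩ hxz
      obtain ⟨p, hp⟩ := SimpleGraph.exists_walk_of_edist_ne_top
        (ne_top_of_le_ne_top (ENat.natCast_ne_top R) hedist)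
      rw [← hp] at hedist
      refine (SimpleGraph.edist_le
        (p.map (SimpleGraph.Embedding.induce (G := G) (Wᶜ : Set V)).toHom)).trans ?_
      rwa [SimpleGraph.Walk.length_map]
    · simp only [ζ, dif_neg h, ne_eq, not_true_eq_false] at hxz
  · by_cases hx : x ∈ W
    · have : ∀ z, ζ x z = 0 := fun z => dif_neg fun h => h.1 hx
      simp [this]
    · exact (hζ1 x hx).le
  · calc ({e ∈ G.edgeSet | ∃ x ∈ W, x ∈ e}.ncard : ℝ) ≤ d * W.ncard := by
          exact_mod_cast G.ncard_edges_meeting_le hd W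
      _ ≤ _ := by linarith
  · have hx : x ∉ W := fun h => hE ⟨hxy, x, h, Sym2.mem_mk_left x y⟩
    have hy : y ∉ W := fun h => hE ⟨hxy, y, h, Sym2.mem_mk_right x y⟩
    refine le_trans ?_ (hvar ⟨x, hx⟩ ⟨y, hy⟩ (by simpa using hxy)).le
    rw [hsum _ fun z hz => by simp [hζW _ z hz], lp.norm_one_eq_sum]
    refine Finset.sum_le_sum fun z _ => ?_
    change |ζ x z - ζ y z| ≤ |ξ ⟨x, hx⟩ z - ξ ⟨y, hy⟩ z|
    rw [hζ ⟨x, hx⟩ z, hζ ⟨y, hy⟩ z]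
    exact abs_abs_sub_abs_le_abs_sub _ _

/-! ### From almost-A or hyperfiniteness to amenability -/

section Sequences

variable {Γ : Type*} [Group Γ] {S : Finset Γ} {V : ℕ → Type*} [∀ n, Fintype (V n)]
  {G : ∀ n, LabelledGraph S (V n)}

theorem IsSoficApproximation.isAmenableGroup_of_slowKernels (hG : IsSoficApproximation S G)
    (hS : Subgroup.closure (S : Set Γ) = ⊤)
    (h : ∀ ε : ℝ, 0 < ε → ∃ R : ℕ, ∀ᶠ n in atTop, ∃ ξ B E,
      IsSlowKernel (G n).toSimpleGraph ε R ξ B E) :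
    IsAmenableGroup Γ := by
  classical
  refine isAmenableGroup_of_right_folner hS fun δ hδ => ?_
  obtain ⟨d, hd⟩ := hG.isGraphSequence.bounded_degree
  have hε : 0 < min (1 / 4) (δ / 2 / (d + 4)) := by positivity
  obtain ⟨R, hR⟩ := h _ hε
  obtain ⟨n, ⟨ξ, B, E, hξ⟩, hbad, hn⟩ := (hR.and
    (((hG.tendsto_not_ballIso (R + R + 1)).eventually_le_const
      (show (0 : ℝ) < 1 / 4 by norm_num)).and
    (hG.isGraphSequence.card_tendsto.eventually_ge_atTop 1))).exists
  rw [Nat.card_eq_fintype_card] at hbad hn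
  obtain ⟨F, hF, hFS⟩ := hξ.exists_right_folner hε.le (hd n) (min_le_left _ _) hδ.le
    (by
      rw [← le_div_iff₀ (by positivity)]
      exact min_le_right _ _) hn ((div_le_iff₀ (by exact_mod_cast hn)).1 hbad)
  exact ⟨F, hF, fun s hs => by convert hFS s hs⟩

theorem IsSoficApproximation.isAmenableGroup_of_isHyperfinite (hG : IsSoficApproximation S G)
    (hS : Subgroup.closure (S : Set Γ) = ⊤) (h : IsHyperfinite fun n => (G n).toSimpleGraph) :
    IsAmenableGroup Γ := by
  classical
  refine hG.isAmenableGroup_of_slowKernels hS fun ε hε => ?_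
  obtain ⟨E, K, l, -, hE, hlim, hl, hK⟩ := h ε hε
  refine ⟨K, ?_⟩
  filter_upwards [hlim.eventually_le_const hl,
    hG.isGraphSequence.card_tendsto.eventually_ge_atTop 1] with n hn hn1
  rw [Nat.card_eq_fintype_card] at hn hn1
  obtain ⟨ρ, hρK, hρ⟩ := SimpleGraph.exists_representatives
    (SimpleGraph.deleteEdges_le (G := (G n).toSimpleGraph) (E n))
    (c := fun x => (((G n).toSimpleGraph.deleteEdges (E n)).connectedComponentMk x).supp.toFinset)
    (K := K) (by simp) (fun x => by
      rw [← Set.ncard_eq_toFinset_card']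
      exact (hK n _).trans K.le_succ) (fun x y hxy => by
      simp only [SimpleGraph.ConnectedComponent.sound hxy.reachable])
  -- The kernel is the point mass at a representative of the component, constant along undeleted
  -- edges; no vertex is exceptional.
  refine ⟨fun x z => if ρ x = z then 1 else 0, ∅, E n, ?_, ?_, ?_, ?_, ?_, ?_, ?_⟩
  · intro x z
    split_ifs <;> simp
  · intro x z hxz
    have : ρ x = z := by by_contra h; simp [h] at hxz
    exact this ▸ hρK x
  · simp
  · simp
  · simp only [Set.ncard_empty, Nat.cast_zero]
    positivity
  · rwa [div_le_iff₀ (by exact_mod_cast hn1)] at hn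
  · intro x y hxy hxyE
    rw [hρ x y (SimpleGraph.deleteEdges_adj.2 ⟨hxy, hxyE⟩)]
    simpa using hε.le

theorem IsSoficApproximation.isAmenableGroup_of_hasPropertyAlmostA (hG : IsSoficApproximation S G)
    (hS : Subgroup.closure (S : Set Γ) = ⊤)
    (h : HasPropertyAlmostA fun n => (G n).toSimpleGraph) :
    IsAmenableGroup Γ := by
  classical
  obtain ⟨d, hd⟩ := hG.isGraphSequence.bounded_degree
  obtain ⟨V', hV', hA⟩ := h
  refine hG.isAmenableGroup_of_slowKernels hS fun ε hε => ?_
  obtain ⟨R, ξ, hξ⟩ := hA ε hε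
  refine ⟨R, ?_⟩
  filter_upwards [hV'.eventually_le_const (show 0 < ε / (d + 1) by positivity),
    hG.isGraphSequence.card_tendsto.eventually_ge_atTop 1] with n hn hn1
  rw [Nat.card_eq_fintype_card] at hn hn1
  rw [div_le_iff₀ (by exact_mod_cast hn1)] at hn
  have hn' : ((d : ℝ) + 1) * (V' n).ncard ≤ ε * Fintype.card (V n) := by
    calc _ ≤ ((d : ℝ) + 1) * (ε / (d + 1) * Fintype.card (V n)) := by gcongr
      _ = _ := by field_simp
  exact exists_isSlowKernel_of_induce (hd n) hn' (hξ n).1 (hξ n).2.1 (hξ n).2.2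

end Sequences

theorem mainTheorem8 {Γ : Type*} [Group Γ] (S : Finset Γ)
    (hS : Subgroup.closure (S : Set Γ) = ⊤)
    (V : ℕ → Type*) [∀ n, Finite (V n)] (G : ∀ n, LabelledGraph S (V n))
    (hG : IsSoficApproximation S G) :
    List.TFAE
      [IsAmenableGroup Γ,
       HasPropertyAlmostA (fun n => (G n).toSimpleGraph),
       IsHyperfinite (fun n => (G n).toSimpleGraph)] := by
  have := fun n => Fintype.ofFinite (V n)
  tfae_have 1 → 2 := fun h => h.hasPropertyAlmostA hS hG
  tfae_have 2 → 1 := fun h => hG.isAmenableGroup_of_hasPropertyAlmostA hS h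
  tfae_have 1 → 3 := fun h => h.isHyperfinite hS hG
  tfae_have 3 → 1 := fun h => hG.isAmenableGroup_of_isHyperfinite hS h
  tfae_finish
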